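/- **Theorem.** Let $\mathsf{Q}=\overline{U}_{\mathrm{i}}\,s\ell(2)$ be the restricted quantum group at $\mathfrak q=\mathrm i$, i.e. the $\mathbb C$-algebra generated by $\mathsf E,\mathsf F,\mathsf K^{\pm1}$ with relations $$\mathsf K\mathsf E\mathsf K^{-1}=-\mathsf E,\quad \mathsf K\mathsf F\mathsf K^{-1}=-\mathsf F,\quad [\mathsf E,\mathsf F]=\frac{\mathsf K-\mathsf K^{-1}}{2\mathrm i},\quad \mathsf E^2=\mathsf F^2=0,\quad \mathsf K^4=\boldsymbol 1,$$ with its usual Hopf algebra structure $$\Delta(\mathsf E)=\boldsymbol 1\otimes\mathsf E+\mathsf E\otimes\mathsf K,\quad \Delta(\mathsf F)=\mathsf K^{-1}\otimes\mathsf F+\mathsf F\otimes\boldsymbol 1,\quad \Delta(\mathsf K)=\mathsf K\otimes\mathsf K,$$ $$\epsilon(\mathsf E)=\epsilon(\mathsf F)=0,\quad \epsilon(\mathsf K)=1,\quad S(\mathsf E)=-\mathsf E\mathsf K^{-1},\quad S(\mathsf F)=-\mathsf K\mathsf F,\quad S(\mathsf K)=\mathsf K^{-1}.$$ Put $\boldsymbol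 e_0=\frac12(\boldsymbol 1+\mathsf K^2)$, $\boldsymbol e_1=\frac12(\boldsymbol 1-\mathsf K^2)$, $\boldsymbol C=\mathsf F\mathsf E-\frac{\mathrm i}{4}(\mathsf K-\mathsf K^{-1})$, and let $\beta\in\mathbb C$ with $\beta^4=-1$. Define $\Phi\in\mathsf Q^{\otimes 3}$ by $$\Phi=\boldsymbol e_0\otimes\boldsymbol e_0\otimes\boldsymbol e_0+\boldsymbol e_1\otimes\boldsymbol e_0\otimes\boldsymbol e_0+\Phi^{010}\,\boldsymbol e_0\otimes\boldsymbol e_1\otimes\boldsymbol e_0+\boldsymbol e_0\otimes\boldsymbol e_0\otimes\boldsymbol e_1+\boldsymbol e_1\otimes\boldsymbol e_1\otimes\boldsymbol e_0+\Phi^{101}\,\boldsymbol e_1\otimes\boldsymbol e_0\otimes\boldsymbol e_1+\boldsymbol e_0\otimes\boldsymbol e_1\otimes\boldsymbol e_1+\Phi^{111}\,\boldsymbol e_1\otimes\boldsymbol e_1\otimes\boldsymbol e_1,$$ where $$\begin{aligned} \Phi^{010}={}&\boldsymbol 1\otimes\boldsymbol 1\otimes\boldsymbol 1-(1+\mathrm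 i)\mathsf E\otimes\mathsf K\otimes\mathsf F+(1-\mathrm i)\mathsf F\mathsf K\otimes\mathsf K\otimes\mathsf E\mathsf K+2\,\mathsf E\mathsf F\mathsf K\otimes\boldsymbol 1\otimes\mathsf E\mathsf F\mathsf K,\\ \Phi^{101}={}&(\mathrm i-1)\boldsymbol 1\otimes\mathsf F\otimes\mathsf E\mathsf K+\boldsymbol 1\otimes\mathsf K\otimes\boldsymbol 1+2\,\boldsymbol 1\otimes\mathsf E\mathsf F\otimes\mathsf E\mathsf F\mathsf K-(1+\mathrm i)\boldsymbol 1\otimes\mathsf E\mathsf K\otimes\mathsf F\\ &-(1+\mathrm i)\mathsf E\otimes\mathsf F\mathsf K\otimes\boldsymbol 1+2\mathrm i\,\mathsf E\otimes\mathsf E\mathsf F\mathsf K\otimes\mathsf F+(1-\mathrm i)\mathsf F\mathsf K\otimes\mathsf E\otimes\boldsymbol 1\\ &-2\mathrm i\,\mathsf F\mathsf K\otimes\mathsf E\mathsf F\mathsf K\otimes\mathsf E\mathsf K-2\,\mathsf E\mathsf F\mathsf K\otimes\mathsf E\mathsf F\otimes\boldsymbol 1,\\ \Phi^{111}={}&\mathrm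 i\beta^2\bigl\{(1+\mathrm i)\boldsymbol 1\otimes\mathsf F\otimes\mathsf E\mathsf K-\boldsymbol 1\otimes\mathsf K\otimes\boldsymbol 1-2\,\boldsymbol 1\otimes\mathsf E\mathsf F\otimes\boldsymbol 1-2\mathrm i\,\boldsymbol 1\otimes\mathsf E\mathsf F\otimes\mathsf E\mathsf F\mathsf K\\ &+(1+\mathrm i)\boldsymbol 1\otimes\mathsf E\mathsf K\otimes\mathsf F-(1+\mathrm i)\mathsf E\otimes\boldsymbol 1\otimes\mathsf F+(1+\mathrm i)\mathsf E\otimes\mathsf F\mathsf K\otimes\boldsymbol 1+2\mathrm i\,\mathsf E\otimes\mathsf F\mathsf K\otimes\mathsf E\mathsf F\mathsf K\\ &+2\,\mathsf E\otimes\mathsf E\mathsf F\mathsf K\otimes\mathsf F-(1+\mathrm i)\mathsf F\mathsf K\otimes\boldsymbol 1\otimes\mathsf E\mathsf K+(1+\mathrm i)\mathsf F\mathsf K\otimes\mathsf E\otimes\boldsymbol 1+2\mathrm i\,\mathsf F\mathsf K\otimes\mathsf E\otimes\mathsf E\mathsf F\mathsf K\\ &+2\,\mathsf F\mathsf K\otimes\mathsf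 E\mathsf F\mathsf K\otimes\mathsf E\mathsf K+2\mathrm i\,\mathsf E\mathsf F\mathsf K\otimes\mathsf F\otimes\mathsf E\mathsf K+2\mathrm i\,\mathsf E\mathsf F\mathsf K\otimes\mathsf K\otimes\mathsf E\mathsf F\mathsf K-2\mathrm i\,\mathsf E\mathsf F\mathsf K\otimes\mathsf E\mathsf F\otimes\boldsymbol 1\\ &+2\mathrm i\,\mathsf E\mathsf F\mathsf K\otimes\mathsf E\mathsf K\otimes\mathsf F+4\,\mathsf E\mathsf F\mathsf K\otimes\mathsf E\mathsf F\otimes\mathsf E\mathsf F\mathsf K\bigr\}, \end{aligned}$$ and define $R\in\mathsf Q^{\otimes2}$ by $R=R^{00}\,\boldsymbol e_0\otimes\boldsymbol e_0+R^{01}\,\boldsymbol e_0\otimes\boldsymbol e_1+R^{10}\,\boldsymbol e_1\otimes\boldsymbol e_0+R^{11}\,\boldsymbol e_1\otimes\boldsymbol e_1$ with $$\begin{aligned} R^{00}={}&\tfrac12(\boldsymbol 1\otimes\boldsymbol 1+\boldsymbol 1\otimes\mathsf K+\mathsf K\otimes\boldsymbol 1-\mathsf K\otimes\mathsf K)\{\boldsymbol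 1\otimes\boldsymbol 1+2\mathrm i\,\mathsf E\otimes\mathsf F\},\\ R^{01}={}&\tfrac12(\boldsymbol 1\otimes\boldsymbol 1-\mathrm i\,\boldsymbol 1\otimes\mathsf K+\mathsf K\otimes\boldsymbol 1+\mathrm i\,\mathsf K\otimes\mathsf K)\{\boldsymbol 1\otimes\boldsymbol 1+(1-\mathrm i)\mathsf F\mathsf K\otimes\mathsf E\mathsf K\\ &-(1-\mathrm i)\mathsf E\otimes\mathsf F+(1+\mathrm i)\mathsf E\mathsf F\mathsf K\otimes\boldsymbol 1+2\mathrm i\,\mathsf E\mathsf F\mathsf K\otimes\mathsf E\mathsf F\mathsf K\},\\ R^{10}={}&\tfrac12(\boldsymbol 1\otimes\boldsymbol 1+\boldsymbol 1\otimes\mathsf K-\mathrm i\,\mathsf K\otimes\boldsymbol 1+\mathrm i\,\mathsf K\otimes\mathsf K)\{\boldsymbol 1\otimes\mathsf K+(1-\mathrm i)\mathsf F\mathsf K\otimes\mathsf E\\ &+(1-\mathrm i)\mathsf E\otimes\mathsf F\mathsf K-(1-\mathrm i)\boldsymbol 1\otimes\mathsf E\mathsf F-2\mathrm i\,\mathsf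 E\mathsf F\mathsf K\otimes\mathsf E\mathsf F\},\\ R^{11}={}&\tfrac{\beta}{2}(\boldsymbol 1\otimes\boldsymbol 1-\mathrm i\,\boldsymbol 1\otimes\mathsf K-\mathrm i\,\mathsf K\otimes\boldsymbol 1+\mathsf K\otimes\mathsf K)\{-\mathrm i\,\mathsf K\otimes\boldsymbol 1+2\mathrm i\,\mathsf E\mathsf K\otimes\mathsf F\\ &+(1-\mathrm i)\mathsf K\otimes\mathsf E\mathsf F\mathsf K-(1+\mathrm i)\mathsf E\mathsf F\otimes\boldsymbol 1-2\mathrm i\,\mathsf E\mathsf F\otimes\mathsf E\mathsf F\mathsf K\}. \end{aligned}$$ Finally let $\boldsymbol\alpha=\boldsymbol 1$ and $\boldsymbol\beta=\boldsymbol e_0-2\mathrm i\beta^2\boldsymbol C\boldsymbol e_1$. Then $\mathsf Q$, with the algebra structure and $\Delta,\epsilon,S$ as above, is a quasi-triangular quasi-Hopf algebra with coassociator $\Phi$, R-matrix $R$, evaluation element $\boldsymbol\alpha$ and coevaluation element $\boldsymbol\beta$. That is: $\Delta,\epsilon$ are algebra homomorphisms with $(\epsilon\otimes\mathrm{id})\Delta=\mathrm{id}=(\mathrm{id}\otimes\epsilon)\Delta$;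 $S$ is an algebra anti-homomorphism; $\Phi$ and $R$ are invertible; for all $a\in\mathsf Q$ $$(\Delta\otimes\mathrm{id})(\Delta(a))=\Phi\,\bigl((\mathrm{id}\otimes\Delta)(\Delta(a))\bigr)\,\Phi^{-1},\qquad R\,\Delta(a)=\Delta^{\mathrm{op}}(a)\,R;$$ $(\mathrm{id}\otimes\epsilon\otimes\mathrm{id})(\Phi)=\boldsymbol 1\otimes\boldsymbol 1$ and $$(\Delta\otimes\mathrm{id}\otimes\mathrm{id})(\Phi)\cdot(\mathrm{id}\otimes\mathrm{id}\otimes\Delta)(\Phi)=(\Phi\otimes\boldsymbol 1)\cdot(\mathrm{id}\otimes\Delta\otimes\mathrm{id})(\Phi)\cdot(\boldsymbol 1\otimes\Phi);$$ $$(\Delta\otimes\mathrm{id})(R)=\Phi_{231}^{-1}R_{13}\Phi_{132}R_{23}\Phi^{-1},\qquad(\mathrm{id}\otimes\Delta)(R)=\Phi_{312}R_{13}\Phi_{213}^{-1}R_{12}\Phi,$$ where for $\Phi=\sum\Phi'\otimes\Phi''\otimes\Phi'''$ one sets $\Phi_{231}=\sum\Phi''\otimes\Phi'''\otimes\Phi'$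 etc.; and, for all $a\in\mathsf Q$, $$\sum S(a')\boldsymbol\alpha a''=\epsilon(a)\boldsymbol\alpha,\quad\sum a'\boldsymbol\beta S(a'')=\epsilon(a)\boldsymbol\beta,\quad\sum S(\Phi')\boldsymbol\alpha\Phi''\boldsymbol\beta S(\Phi''')=\boldsymbol 1,\quad\sum(\Phi^{-1})'\boldsymbol\beta S((\Phi^{-1})'')\boldsymbol\alpha(\Phi^{-1})'''=\boldsymbol 1.$$ Moreover, $R^{00}$ equals the standard R-matrix $R^{\mathrm{st}}=\frac12\sum_{m,n=0,1}(-1)^{mn}\mathsf K^m\otimes\mathsf K^n(\boldsymbol 1\otimes\boldsymbol 1+2\mathrm i\,\mathsf E\otimes\mathsf F)$, so that $R\cdot(\boldsymbol e_0\otimes\boldsymbol e_0)=R^{\mathrm{st}}\cdot(\boldsymbol e_0\otimes\boldsymbol e_0)$. -/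

import Mathlib

open scoped TensorProduct

noncomputable section

/-! Quasi-triangular quasi-Hopf algebras over the complex numbers (with trivial unit
isomorphisms).  Threefold and fourfold tensor powers are bracketed to the right. -/

namespace QuasiHopf

variable (A : Type) [Ring A] [Algebra ℂ A]

/-- The threefold tensor power of `A`. -/
abbrev T3 : Type := A ⊗[ℂ] (A ⊗[ℂ] A)

/-- The fourfold tensor power of `A`. -/
abbrev T4 : Type := A ⊗[ℂ] (A ⊗[ℂ] (A ⊗[ℂ] A))

variable {A}

/-- `Δ ⊗ id : A ⊗ A → A ⊗ A ⊗ A`. -/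
def comulId (Δ : A →ₐ[ℂ] A ⊗[ℂ] A) : A ⊗[ℂ] A →ₐ[ℂ] T3 A :=
  (Algebra.TensorProduct.assoc ℂ ℂ ℂ A A A).toAlgHom.comp
    (Algebra.TensorProduct.map Δ (AlgHom.id ℂ A))

/-- `id ⊗ Δ : A ⊗ A → A ⊗ A ⊗ A`. -/
def idComul (Δ : A →ₐ[ℂ] A ⊗[ℂ] A) : A ⊗[ℂ] A →ₐ[ℂ] T3 A :=
  Algebra.TensorProduct.map (AlgHom.id ℂ A) Δ

/-- `Δ ⊗ id ⊗ id : A ⊗ A ⊗ A → A ⊗ A ⊗ A ⊗ A`. -/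
def comulIdId (Δ : A →ₐ[ℂ] A ⊗[ℂ] A) : T3 A →ₐ[ℂ] T4 A :=
  (Algebra.TensorProduct.assoc ℂ ℂ ℂ A A (A ⊗[ℂ] A)).toAlgHom.comp
    (Algebra.TensorProduct.map Δ (AlgHom.id ℂ (A ⊗[ℂ] A)))

/-- `id ⊗ Δ ⊗ id : A ⊗ A ⊗ A → A ⊗ A ⊗ A ⊗ A`. -/
def idComulId (Δ : A →ₐ[ℂ] A ⊗[ℂ] A) : T3 A →ₐ[ℂ] T4 A :=
  Algebra.TensorProduct.map (AlgHom.id ℂ A) (comulId Δ)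

/-- `id ⊗ id ⊗ Δ : A ⊗ A ⊗ A → A ⊗ A ⊗ A ⊗ A`. -/
def idIdComul (Δ : A →ₐ[ℂ] A ⊗[ℂ] A) : T3 A →ₐ[ℂ] T4 A :=
  Algebra.TensorProduct.map (AlgHom.id ℂ A) (idComul Δ)

/-- `X ↦ X ⊗ 1`, from `A ⊗ A ⊗ A` to `A ⊗ A ⊗ A ⊗ A`. -/
def tensorOne : T3 A →ₐ[ℂ] T4 A :=
  Algebra.TensorProduct.map (AlgHom.id ℂ A)
    (Algebra.TensorProduct.map (AlgHom.id ℂ A) Algebra.TensorProduct.includeLeft)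

/-- `X ↦ 1 ⊗ X`, from `A ⊗ A ⊗ A` to `A ⊗ A ⊗ A ⊗ A`. -/
def oneTensor : T3 A →ₐ[ℂ] T4 A :=
  Algebra.TensorProduct.includeRight

/-- `id ⊗ ε ⊗ id : A ⊗ A ⊗ A → A ⊗ A`. -/
def idCounitId (ε : A →ₐ[ℂ] ℂ) : T3 A →ₐ[ℂ] A ⊗[ℂ] A :=
  Algebra.TensorProduct.map (AlgHom.id ℂ A)
    ((Algebra.TensorProduct.lid ℂ A).toAlgHom.comp
      (Algebra.TensorProduct.map ε (AlgHom.id ℂ A)))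

/-- `x ⊗ y ↦ x ⊗ y ⊗ 1`. -/
def leg12 : A ⊗[ℂ] A →ₐ[ℂ] T3 A :=
  Algebra.TensorProduct.map (AlgHom.id ℂ A) Algebra.TensorProduct.includeLeft

/-- `x ⊗ y ↦ x ⊗ 1 ⊗ y`. -/
def leg13 : A ⊗[ℂ] A →ₐ[ℂ] T3 A :=
  Algebra.TensorProduct.map (AlgHom.id ℂ A) Algebra.TensorProduct.includeRight

/-- `x ⊗ y ↦ 1 ⊗ x ⊗ y`. -/
def leg23 : A ⊗[ℂ] A →ₐ[ℂ] T3 A :=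
  Algebra.TensorProduct.includeRight

/-- `x ⊗ y ↦ y ⊗ x`. -/
def flip : A ⊗[ℂ] A →ₐ[ℂ] A ⊗[ℂ] A :=
  (Algebra.TensorProduct.comm ℂ A A).toAlgHom

/-- `x ⊗ y ⊗ z ↦ x ⊗ z ⊗ y`. -/
def perm132 : T3 A →ₐ[ℂ] T3 A :=
  Algebra.TensorProduct.map (AlgHom.id ℂ A) flip

/-- `x ⊗ y ⊗ z ↦ y ⊗ x ⊗ z`. -/
def perm213 : T3 A →ₐ[ℂ] T3 A :=
  (Algebra.TensorProduct.leftComm ℂ A A A).toAlgHom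

/-- `x ⊗ y ⊗ z ↦ y ⊗ z ⊗ x`. -/
def perm231 : T3 A →ₐ[ℂ] T3 A :=
  perm132.comp perm213

/-- `x ⊗ y ⊗ z ↦ z ⊗ x ⊗ y`. -/
def perm312 : T3 A →ₐ[ℂ] T3 A :=
  perm213.comp perm132

/-- The linear map `x ⊗ y ↦ f x * c * g y`. -/
def sandwich₂ (f : A →ₗ[ℂ] A) (c : A) (g : A →ₗ[ℂ] A) : A ⊗[ℂ] A →ₗ[ℂ] A :=
  LinearMap.mul' ℂ A ∘ₗ TensorProduct.map f (LinearMap.mulLeft ℂ c ∘ₗ g)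

/-- The linear map `x ⊗ y ⊗ z ↦ f x * c * g y * d * h z`. -/
def sandwich₃ (f : A →ₗ[ℂ] A) (c : A) (g : A →ₗ[ℂ] A) (d : A) (h : A →ₗ[ℂ] A) :
    T3 A →ₗ[ℂ] A :=
  LinearMap.mul' ℂ A ∘ₗ
    TensorProduct.map f (LinearMap.mulLeft ℂ c ∘ₗ sandwich₂ g d h)

/-- On pure tensors the maps above are given by the formulas in their descriptions. -/
theorem maps_tmul (Δ : A →ₐ[ℂ] A ⊗[ℂ] A) (ε : A →ₐ[ℂ] ℂ) (f g h : A →ₗ[ℂ] A)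
    (c d x y z : A) :
    idComul Δ (x ⊗ₜ y) = x ⊗ₜ Δ y ∧
    idCounitId ε (x ⊗ₜ (y ⊗ₜ z)) = x ⊗ₜ (ε y • z) ∧
    tensorOne (x ⊗ₜ (y ⊗ₜ z)) = (x ⊗ₜ (y ⊗ₜ (z ⊗ₜ 1)) : T4 A) ∧
    oneTensor (x ⊗ₜ (y ⊗ₜ z)) = (1 ⊗ₜ (x ⊗ₜ (y ⊗ₜ z)) : T4 A) ∧
    leg12 (x ⊗ₜ y) = (x ⊗ₜ (y ⊗ₜ 1) : T3 A) ∧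
    leg13 (x ⊗ₜ y) = (x ⊗ₜ (1 ⊗ₜ y) : T3 A) ∧
    leg23 (x ⊗ₜ y) = (1 ⊗ₜ (x ⊗ₜ y) : T3 A) ∧
    flip (x ⊗ₜ y) = (y ⊗ₜ x : A ⊗[ℂ] A) ∧
    perm132 (x ⊗ₜ (y ⊗ₜ z)) = (x ⊗ₜ (z ⊗ₜ y) : T3 A) ∧
    perm213 (x ⊗ₜ (y ⊗ₜ z)) = (y ⊗ₜ (x ⊗ₜ z) : T3 A) ∧
    perm231 (x ⊗ₜ (y ⊗ₜ z)) = (y ⊗ₜ (z ⊗ₜ x) : T3 A) ∧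
    perm312 (x ⊗ₜ (y ⊗ₜ z)) = (z ⊗ₜ (x ⊗ₜ y) : T3 A) ∧
    sandwich₂ f c g (x ⊗ₜ y) = f x * c * g y ∧
    sandwich₃ f c g d h (x ⊗ₜ (y ⊗ₜ z)) = f x * c * g y * d * h z := by
  refine ⟨?_, ?_, ?_, ?_, ?_, ?_, ?_, ?_, ?_, ?_, ?_, ?_, ?_, ?_⟩ <;>
    simp [idComul, idCounitId, tensorOne, oneTensor, leg12, leg13, leg23, flip, perm132,
      perm213, perm231, perm312, sandwich₂, sandwich₃, mul_assoc]

variable (A)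

/-- The structure of a quasi-bialgebra on the algebra `A`. -/
structure QuasiBialgebra where
  /-- the comultiplication -/
  comul : A →ₐ[ℂ] A ⊗[ℂ] A
  /-- the counit -/
  counit : A →ₐ[ℂ] ℂ
  /-- the coassociator, an invertible element -/
  coassociator : (T3 A)ˣ
  /-- `(ε ⊗ id) ∘ Δ = id` -/
  counit_comul : ∀ a : A, Algebra.TensorProduct.lid ℂ A
    (Algebra.TensorProduct.map counit (AlgHom.id ℂ A) (comul a)) = a
  /-- `(id ⊗ ε) ∘ Δ = id` -/
  comul_counit : ∀ a : A, Algebra.TensorProduct.rid ℂ ℂ A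
    (Algebra.TensorProduct.map (AlgHom.id ℂ A) counit (comul a)) = a
  /-- quasi-coassociativity, `(Δ ⊗ id)(Δ a) = Φ (id ⊗ Δ)(Δ a) Φ⁻¹` -/
  quasi_coassoc : ∀ a : A, comulId comul (comul a) =
    (coassociator : T3 A) * idComul comul (comul a) * ((coassociator⁻¹ : (T3 A)ˣ) : T3 A)
  /-- `(id ⊗ ε ⊗ id)(Φ) = 1 ⊗ 1` -/
  coassociator_counital : idCounitId counit (coassociator : T3 A) = 1
  /-- the 3-cocycle condition
  `(Δ ⊗ id ⊗ id)(Φ) (id ⊗ id ⊗ Δ)(Φ) = (Φ ⊗ 1) (id ⊗ Δ ⊗ id)(Φ) (1 ⊗ Φ)` -/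
  cocycle : comulIdId comul (coassociator : T3 A) * idIdComul comul (coassociator : T3 A) =
    tensorOne (coassociator : T3 A) * idComulId comul (coassociator : T3 A) *
      oneTensor (coassociator : T3 A)

/-- The structure of a quasi-triangular quasi-bialgebra on the algebra `A`. -/
structure QuasiTriangularQuasiBialgebra extends QuasiBialgebra A where
  /-- the universal R-matrix, an invertible element -/
  rMatrix : (A ⊗[ℂ] A)ˣ
  /-- `R Δ(a) = Δᵒᵖ(a) R` -/
  rMatrix_comul : ∀ a : A,
    (rMatrix : A ⊗[ℂ] A) * comul a = flip (comul a) * (rMatrix : A ⊗[ℂ] A)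
  /-- `(Δ ⊗ id)(R) = Φ₂₃₁⁻¹ R₁₃ Φ₁₃₂ R₂₃ Φ⁻¹` -/
  comulId_rMatrix : comulId comul (rMatrix : A ⊗[ℂ] A) =
    perm231 ((coassociator⁻¹ : (T3 A)ˣ) : T3 A) * leg13 (rMatrix : A ⊗[ℂ] A) *
      perm132 (coassociator : T3 A) * leg23 (rMatrix : A ⊗[ℂ] A) *
      ((coassociator⁻¹ : (T3 A)ˣ) : T3 A)
  /-- `(id ⊗ Δ)(R) = Φ₃₁₂ R₁₃ Φ₂₁₃⁻¹ R₁₂ Φ` -/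
  idComul_rMatrix : idComul comul (rMatrix : A ⊗[ℂ] A) =
    perm312 (coassociator : T3 A) * leg13 (rMatrix : A ⊗[ℂ] A) *
      perm213 ((coassociator⁻¹ : (T3 A)ˣ) : T3 A) * leg12 (rMatrix : A ⊗[ℂ] A) *
      (coassociator : T3 A)

/-- The structure of a quasi-triangular quasi-Hopf algebra on the algebra `A`. -/
structure QuasiTriangularQuasiHopfAlgebra extends QuasiTriangularQuasiBialgebra A where
  /-- the antipode, an anti-homomorphism of algebras -/
  antipode : A →ₗ[ℂ] A
  /-- the evaluation element `α` -/
  evalElt : A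
  /-- the coevaluation element `β` -/
  coevalElt : A
  antipode_one : antipode 1 = 1
  antipode_mul : ∀ a b : A, antipode (a * b) = antipode b * antipode a
  /-- `∑ S(a') α a'' = ε(a) α` -/
  antipode_evalElt : ∀ a : A,
    sandwich₂ antipode evalElt LinearMap.id (comul a) = counit a • evalElt
  /-- `∑ a' β S(a'') = ε(a) β` -/
  coevalElt_antipode : ∀ a : A,
    sandwich₂ LinearMap.id coevalElt antipode (comul a) = counit a • coevalElt
  /-- `∑ S(Φ') α Φ'' β S(Φ''') = 1` -/
  sandwich_coassociator :
    sandwich₃ antipode evalElt LinearMap.id coevalElt antipode (coassociator : T3 A) = 1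
  /-- `∑ (Φ⁻¹)' β S((Φ⁻¹)'') α (Φ⁻¹)''' = 1` -/
  sandwich_coassociator_inv :
    sandwich₃ LinearMap.id coevalElt antipode evalElt LinearMap.id
      ((coassociator⁻¹ : (T3 A)ˣ) : T3 A) = 1

end QuasiHopf

/-! The restricted quantum group of `sl(2)` at `q = i`. -/

namespace RestrictedSL2

/-- Names of the generators `E`, `F`, `K`, `K⁻¹`. -/
inductive Gen : Type
  | E
  | F
  | K
  | Kinv

/-- The defining relations at `q = i` (so `q² = q⁻² = -1` and `q - q⁻¹ = 2i`). -/
inductive Rel : FreeAlgebra ℂ Gen → FreeAlgebra ℂ Gen → Prop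
  | K_mul_Kinv : Rel (FreeAlgebra.ι ℂ Gen.K * FreeAlgebra.ι ℂ Gen.Kinv) 1
  | Kinv_mul_K : Rel (FreeAlgebra.ι ℂ Gen.Kinv * FreeAlgebra.ι ℂ Gen.K) 1
  | K_E : Rel (FreeAlgebra.ι ℂ Gen.K * FreeAlgebra.ι ℂ Gen.E * FreeAlgebra.ι ℂ Gen.Kinv)
      (-FreeAlgebra.ι ℂ Gen.E)
  | K_F : Rel (FreeAlgebra.ι ℂ Gen.K * FreeAlgebra.ι ℂ Gen.F * FreeAlgebra.ι ℂ Gen.Kinv)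
      (-FreeAlgebra.ι ℂ Gen.F)
  | E_F : Rel (FreeAlgebra.ι ℂ Gen.E * FreeAlgebra.ι ℂ Gen.F -
        FreeAlgebra.ι ℂ Gen.F * FreeAlgebra.ι ℂ Gen.E)
      ((2 * Complex.I)⁻¹ • (FreeAlgebra.ι ℂ Gen.K - FreeAlgebra.ι ℂ Gen.Kinv))
  | E_sq : Rel (FreeAlgebra.ι ℂ Gen.E ^ 2) 0
  | F_sq : Rel (FreeAlgebra.ι ℂ Gen.F ^ 2) 0
  | K_pow : Rel (FreeAlgebra.ι ℂ Gen.K ^ 4) 1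

/-- The restricted quantum group of `sl(2)` at `q = i`, as an algebra. -/
def Q : Type := RingQuot Rel

instance : Ring Q := inferInstanceAs (Ring (RingQuot Rel))

instance : Algebra ℂ Q := inferInstanceAs (Algebra ℂ (RingQuot Rel))

/-- The projection of the free algebra onto `Q`. -/
def proj : FreeAlgebra ℂ Gen →ₐ[ℂ] Q := RingQuot.mkAlgHom ℂ Rel

/-- The class in `Q` of a generator. -/
def gen (g : Gen) : Q := proj (FreeAlgebra.ι ℂ g)

theorem proj_rel {x y : FreeAlgebra ℂ Gen} (h : Rel x y) : proj x = proj y :=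
  RingQuot.mkAlgHom_rel ℂ h

/-- The universal property of `Q`: an algebra homomorphism out of `Q` is given by images of the
generators that satisfy the defining relations. -/
def lift {B : Type} [Ring B] [Algebra ℂ B] (f : Gen → B)
    (hf : ∀ ⦃x y : FreeAlgebra ℂ Gen⦄, Rel x y →
      FreeAlgebra.lift ℂ f x = FreeAlgebra.lift ℂ f y) : Q →ₐ[ℂ] B :=
  RingQuot.liftAlgHom ℂ ⟨FreeAlgebra.lift ℂ f, hf⟩

theorem lift_gen {B : Type} [Ring B] [Algebra ℂ B] (f : Gen → B)
    (hf : ∀ ⦃x y : FreeAlgebra ℂ Gen⦄, Rel x y →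
      FreeAlgebra.lift ℂ f x = FreeAlgebra.lift ℂ f y) (g : Gen) : lift f hf (gen g) = f g := by
  have h := RingQuot.liftAlgHom_mkAlgHom_apply ℂ (FreeAlgebra.lift ℂ f) hf (FreeAlgebra.ι ℂ g)
  rw [FreeAlgebra.lift_ι_apply] at h
  exact h

abbrev E : Q := gen Gen.E
abbrev F : Q := gen Gen.F
abbrev K : Q := gen Gen.K
abbrev Kinv : Q := gen Gen.Kinv

theorem K_mul_Kinv : K * Kinv = 1 := by
  simpa [gen] using proj_rel Rel.K_mul_Kinv

theorem Kinv_mul_K : Kinv * K = 1 := by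
  simpa [gen] using proj_rel Rel.Kinv_mul_K

theorem K_mul_E : K * E = -(E * K) := by
  have h : K * E * Kinv = -E := by
    simpa [gen] using proj_rel Rel.K_E
  calc K * E = K * E * (Kinv * K) := by rw [Kinv_mul_K, mul_one]
    _ = K * E * Kinv * K := by rw [mul_assoc, mul_assoc, mul_assoc]
    _ = -(E * K) := by rw [h, neg_mul]

theorem K_mul_F : K * F = -(F * K) := by
  have h : K * F * Kinv = -F := by
    simpa [gen] using proj_rel Rel.K_F
  calc K * F = K * F * (Kinv * K) := by rw [Kinv_mul_K, mul_one]
    _ = K * F * Kinv * K := by rw [mul_assoc, mul_assoc, mul_assoc]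
    _ = -(F * K) := by rw [h, neg_mul]

theorem E_mul_F : E * F - F * E = (2 * Complex.I)⁻¹ • (K - Kinv) := by
  simpa only [gen, map_sub, map_mul, map_smul] using proj_rel Rel.E_F

theorem E_sq : E * E = 0 := by
  simpa [gen, pow_two] using proj_rel Rel.E_sq

theorem F_sq : F * F = 0 := by
  simpa [gen, pow_two] using proj_rel Rel.F_sq

theorem K_pow : K ^ 4 = 1 := by
  simpa [gen] using proj_rel Rel.K_pow

theorem Kinv_mul_E : Kinv * E = -(E * Kinv) := by
  calc Kinv * E = Kinv * E * (K * Kinv) := by rw [K_mul_Kinv, mul_one]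
    _ = Kinv * (E * K) * Kinv := by simp only [mul_assoc]
    _ = -((Kinv * K) * E * Kinv) := by
      rw [← neg_neg (E * K), ← K_mul_E]; simp only [mul_assoc, mul_neg, neg_mul]
    _ = -(E * Kinv) := by rw [Kinv_mul_K, one_mul]

theorem Kinv_mul_F : Kinv * F = -(F * Kinv) := by
  calc Kinv * F = Kinv * F * (K * Kinv) := by rw [K_mul_Kinv, mul_one]
    _ = Kinv * (F * K) * Kinv := by simp only [mul_assoc]
    _ = -((Kinv * K) * F * Kinv) := by
      rw [← neg_neg (F * K), ← K_mul_F]; simp only [mul_assoc, mul_neg, neg_mul]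
    _ = -(F * Kinv) := by rw [Kinv_mul_K, one_mul]

theorem Kinv_pow : Kinv ^ 4 = 1 := by
  have h : Commute Kinv K := by rw [Commute, SemiconjBy, Kinv_mul_K, K_mul_Kinv]
  have h2 : (Kinv * K) ^ 4 = 1 := by rw [Kinv_mul_K, one_pow]
  rwa [h.mul_pow, K_pow, mul_one] at h2

/-- Two algebra homomorphisms out of `Q` that agree on the generators are equal. -/
theorem algHom_ext {B : Type*} [Semiring B] [Algebra ℂ B] {f g : Q →ₐ[ℂ] B}
    (h : ∀ x, f (gen x) = g (gen x)) : f = g := by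
  apply RingQuot.ringQuot_ext'
  apply FreeAlgebra.hom_ext
  funext x
  exact h x

/-- Values of the comultiplication on generators. -/
def comulGen : Gen → Q ⊗[ℂ] Q
  | Gen.E => 1 ⊗ₜ E + E ⊗ₜ K
  | Gen.F => Kinv ⊗ₜ F + F ⊗ₜ 1
  | Gen.K => K ⊗ₜ K
  | Gen.Kinv => Kinv ⊗ₜ Kinv

/-- Values of the counit on generators. -/
def counitGen : Gen → ℂ
  | Gen.E => 0
  | Gen.F => 0
  | Gen.K => 1
  | Gen.Kinv => 1

/-- Values of the antipode on generators, in the opposite algebra. -/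
def antipodeGen : Gen → Qᵐᵒᵖ
  | Gen.E => MulOpposite.op (-(E * Kinv))
  | Gen.F => MulOpposite.op (-(K * F))
  | Gen.K => MulOpposite.op Kinv
  | Gen.Kinv => MulOpposite.op K

theorem F_mul_E : F * E = E * F - (2 * Complex.I)⁻¹ • (K - Kinv) := by
  rw [← E_mul_F]; abel

/-- The relations as left-to-right rewriting rules inside longer products. -/
theorem normalize (x : Q) :
    K * (Kinv * x) = x ∧ Kinv * (K * x) = x ∧ K * (E * x) = -(E * (K * x)) ∧
    K * (F * x) = -(F * (K * x)) ∧ Kinv * (E * x) = -(E * (Kinv * x)) ∧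
    Kinv * (F * x) = -(F * (Kinv * x)) ∧ E * (E * x) = 0 ∧ F * (F * x) = 0 ∧
    F * (E * x) = E * (F * x) - (2 * Complex.I)⁻¹ • (K * x - Kinv * x) := by
  refine ⟨?_, ?_, ?_, ?_, ?_, ?_, ?_, ?_, ?_⟩
  · rw [← mul_assoc, K_mul_Kinv, one_mul]
  · rw [← mul_assoc, Kinv_mul_K, one_mul]
  · rw [← mul_assoc, K_mul_E, neg_mul, mul_assoc]
  · rw [← mul_assoc, K_mul_F, neg_mul, mul_assoc]
  · rw [← mul_assoc, Kinv_mul_E, neg_mul, mul_assoc]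
  · rw [← mul_assoc, Kinv_mul_F, neg_mul, mul_assoc]
  · rw [← mul_assoc, E_sq, zero_mul]
  · rw [← mul_assoc, F_sq, zero_mul]
  · rw [← mul_assoc, F_mul_E, sub_mul, smul_mul_assoc, sub_mul, mul_assoc]

theorem comulGen_rel ⦃x y : FreeAlgebra ℂ Gen⦄ (h : Rel x y) :
    FreeAlgebra.lift ℂ comulGen x = FreeAlgebra.lift ℂ comulGen y := by
  cases h <;> simp only [map_mul, map_sub, map_neg, map_smul, map_pow, map_one, map_zero,
    FreeAlgebra.lift_ι_apply, comulGen, pow_two, mul_add, add_mul,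
    Algebra.TensorProduct.tmul_mul_tmul, Algebra.TensorProduct.tmul_pow, K_pow, mul_one, one_mul,
    mul_assoc, K_mul_Kinv, Kinv_mul_K, K_mul_E, K_mul_F, Kinv_mul_E, E_sq, F_sq, F_mul_E,
    Kinv_mul_F, normalize, TensorProduct.tmul_neg, TensorProduct.neg_tmul,
    TensorProduct.tmul_zero, TensorProduct.zero_tmul, Algebra.TensorProduct.one_def]
  · abel
  · abel
  · simp only [TensorProduct.tmul_sub, TensorProduct.sub_tmul, TensorProduct.tmul_smul,
      ← TensorProduct.smul_tmul', smul_sub]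
    abel
  · abel
  · abel

theorem counitGen_rel ⦃x y : FreeAlgebra ℂ Gen⦄ (h : Rel x y) :
    FreeAlgebra.lift ℂ counitGen x = FreeAlgebra.lift ℂ counitGen y := by
  cases h <;> simp [counitGen]

theorem antipodeGen_rel ⦃x y : FreeAlgebra ℂ Gen⦄ (h : Rel x y) :
    FreeAlgebra.lift ℂ antipodeGen x = FreeAlgebra.lift ℂ antipodeGen y := by
  cases h <;> simp only [map_mul, map_sub, map_neg, map_smul, map_pow, map_one, map_zero,
    FreeAlgebra.lift_ι_apply, antipodeGen, pow_two, ← MulOpposite.op_mul, ← MulOpposite.op_sub,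
    ← MulOpposite.op_neg, ← MulOpposite.op_smul, ← MulOpposite.op_one, ← MulOpposite.op_zero,
    ← MulOpposite.op_pow] <;> congr 1
  · exact K_mul_Kinv
  · exact Kinv_mul_K
  · simp [mul_assoc, normalize]
  · simp [mul_assoc, K_mul_Kinv, normalize]
  · simp only [neg_mul, mul_assoc, normalize, mul_neg, K_mul_Kinv, neg_neg, mul_one,
      mul_sub, mul_smul_comm, smul_sub]
    abel
  · simp [mul_assoc, normalize]
  · simp [mul_assoc, normalize, K_mul_F]
  · exact Kinv_pow

/-- The comultiplication of `Q`. -/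
def comulHom : Q →ₐ[ℂ] Q ⊗[ℂ] Q := lift comulGen comulGen_rel

/-- The counit of `Q`. -/
def counitHom : Q →ₐ[ℂ] ℂ := lift counitGen counitGen_rel

/-- The antipode of `Q`, as an algebra homomorphism to the opposite algebra. -/
def antipodeOp : Q →ₐ[ℂ] Qᵐᵒᵖ := lift antipodeGen antipodeGen_rel

/-- The antipode of `Q`. -/
def antipodeMap : Q →ₗ[ℂ] Q :=
  (MulOpposite.opLinearEquiv ℂ).symm.toLinearMap ∘ₗ antipodeOp.toLinearMap

theorem antipodeMap_one : antipodeMap 1 = 1 := by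
  simp [antipodeMap]

theorem antipodeMap_mul (a b : Q) : antipodeMap (a * b) = antipodeMap b * antipodeMap a := by
  simp [antipodeMap]

theorem comulHom_gen (g : Gen) : comulHom (gen g) = comulGen g := lift_gen _ _ g

theorem counitHom_gen (g : Gen) : counitHom (gen g) = counitGen g := lift_gen _ _ g

theorem antipodeMap_gen (g : Gen) : antipodeMap (gen g) = (antipodeGen g).unop :=
  congrArg MulOpposite.unop (lift_gen antipodeGen antipodeGen_rel g)

instance : Bialgebra ℂ Q :=
  Bialgebra.ofAlgHom comulHom counitHom
    (by
      apply algHom_ext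
      intro x
      cases x <;> simp [comulHom_gen, comulGen, TensorProduct.tmul_add, TensorProduct.add_tmul,
        Algebra.TensorProduct.one_def, add_assoc])
    (by
      apply algHom_ext
      intro x
      cases x <;> simp [comulHom_gen, comulGen, counitHom_gen, counitGen])
    (by
      apply algHom_ext
      intro x
      cases x <;> simp [comulHom_gen, comulGen, counitHom_gen, counitGen])

/-- An induction principle: a property closed under sums and products that holds for scalars and
generators holds on all of `Q`. -/
theorem induction {p : Q → Prop} (h1 : ∀ c : ℂ, p (algebraMap ℂ Q c)) (hg : ∀ g, p (gen g))
    (hm : ∀ a b, p a → p b → p (a * b)) (ha : ∀ a b, p a → p b → p (a + b)) (x : Q) : p x := by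
  obtain ⟨y, rfl⟩ : ∃ y, proj y = x := RingQuot.mkAlgHom_surjective ℂ Rel x
  induction y using FreeAlgebra.induction with
  | grade0 r => rw [AlgHom.commutes]; exact h1 r
  | grade1 g => exact hg g
  | mul a b h h' => rw [map_mul]; exact hm _ _ h h'
  | add a b h h' => rw [map_add]; exact ha _ _ h h'

theorem mul_antipode_left (s t : Q ⊗[ℂ] Q) (c : ℂ)
    (hs : LinearMap.mul' ℂ Q (antipodeMap.rTensor Q s) = algebraMap ℂ Q c) :
    LinearMap.mul' ℂ Q (antipodeMap.rTensor Q (s * t)) =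
      algebraMap ℂ Q c * LinearMap.mul' ℂ Q (antipodeMap.rTensor Q t) := by
  induction t using TensorProduct.induction_on with
  | zero => simp
  | add a b h h' => simp only [mul_add, map_add, h, h']
  | tmul x y =>
    have key : ∀ r : Q ⊗[ℂ] Q, LinearMap.mul' ℂ Q (antipodeMap.rTensor Q (r * x ⊗ₜ y)) =
        antipodeMap x * LinearMap.mul' ℂ Q (antipodeMap.rTensor Q r) * y := by
      intro r
      induction r using TensorProduct.induction_on with
      | zero => simp
      | add a b h h' => simp only [mul_add, add_mul, map_add, h, h']
      | tmul u v => simp [antipodeMap_mul, mul_assoc]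
    rw [key, hs, ← Algebra.commutes, mul_assoc]
    simp

theorem mul_antipode_right (s t : Q ⊗[ℂ] Q) (c : ℂ)
    (ht : LinearMap.mul' ℂ Q (antipodeMap.lTensor Q t) = algebraMap ℂ Q c) :
    LinearMap.mul' ℂ Q (antipodeMap.lTensor Q (s * t)) =
      LinearMap.mul' ℂ Q (antipodeMap.lTensor Q s) * algebraMap ℂ Q c := by
  induction s using TensorProduct.induction_on with
  | zero => simp
  | add a b h h' => simp only [add_mul, map_add, h, h']
  | tmul x y =>
    have key : ∀ r : Q ⊗[ℂ] Q, LinearMap.mul' ℂ Q (antipodeMap.lTensor Q (x ⊗ₜ y * r)) =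
        x * LinearMap.mul' ℂ Q (antipodeMap.lTensor Q r) * antipodeMap y := by
      intro r
      induction r using TensorProduct.induction_on with
      | zero => simp
      | add a b h h' => simp only [mul_add, add_mul, map_add, h, h']
      | tmul u v => simp [antipodeMap_mul, mul_assoc]
    rw [key, ht, mul_assoc, Algebra.commutes, ← mul_assoc]
    simp

theorem antipode_comul_left (x : Q) :
    LinearMap.mul' ℂ Q (antipodeMap.rTensor Q (comulHom x)) = algebraMap ℂ Q (counitHom x) := by
  induction x using induction with
  | h1 c => simp [Algebra.algebraMap_eq_smul_one, Algebra.TensorProduct.one_def, antipodeMap_one]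
  | hg g =>
    cases g <;> simp [comulHom_gen, comulGen, counitHom_gen, counitGen, antipodeMap_gen,
      antipodeGen, antipodeMap_one, mul_assoc, K_mul_Kinv, Kinv_mul_K]
  | ha a b h h' => simp only [map_add, h, h']
  | hm a b h h' =>
    rw [map_mul, mul_antipode_left _ _ _ h, h', map_mul, map_mul]

theorem antipode_comul_right (x : Q) :
    LinearMap.mul' ℂ Q (antipodeMap.lTensor Q (comulHom x)) = algebraMap ℂ Q (counitHom x) := by
  induction x using induction with
  | h1 c => simp [Algebra.algebraMap_eq_smul_one, Algebra.TensorProduct.one_def, antipodeMap_one]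
  | hg g =>
    cases g <;> simp [comulHom_gen, comulGen, counitHom_gen, counitGen, antipodeMap_gen,
      antipodeGen, antipodeMap_one, K_mul_Kinv, Kinv_mul_K, normalize]
  | ha a b h h' => simp only [map_add, h, h']
  | hm a b h h' =>
    rw [map_mul, mul_antipode_right _ _ _ h', h, map_mul, map_mul]

/-- The Hopf algebra structure of `Q`. -/
instance : HopfAlgebra ℂ Q where
  antipode := antipodeMap
  mul_antipode_rTensor_comul := LinearMap.ext antipode_comul_left
  mul_antipode_lTensor_comul := LinearMap.ext antipode_comul_right

theorem comulAlgHom_gen (g : Gen) : Bialgebra.comulAlgHom ℂ Q (gen g) = comulGen g :=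
  comulHom_gen g

theorem counitAlgHom_gen (g : Gen) : Bialgebra.counitAlgHom ℂ Q (gen g) = counitGen g :=
  counitHom_gen g

theorem antipode_gen (g : Gen) :
    HopfAlgebra.antipode ℂ (gen g) = (antipodeGen g).unop :=
  antipodeMap_gen g

open Complex (I)
open QuasiHopf (T3)

/-- The central idempotent `e₀ = (1 + K²) / 2`. -/
def e0 : Q := (1 / 2 : ℂ) • (1 + K ^ 2)

/-- The central idempotent `e₁ = (1 - K²) / 2`. -/
def e1 : Q := (1 / 2 : ℂ) • (1 - K ^ 2)

/-- The component `Φ⁰¹⁰` of the coassociator. -/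
def Phi010 : T3 Q :=
  1 ⊗ₜ (1 ⊗ₜ 1)
  - (1 + I) • E ⊗ₜ (K ⊗ₜ F)
  + (1 - I) • (F * K) ⊗ₜ (K ⊗ₜ (E * K))
  + (2 : ℂ) • (E * F * K) ⊗ₜ (1 ⊗ₜ (E * F * K))

/-- The component `Φ¹⁰¹` of the coassociator. -/
def Phi101 : T3 Q :=
  (I - 1) • 1 ⊗ₜ (F ⊗ₜ (E * K))
  + 1 ⊗ₜ (K ⊗ₜ 1)
  + (2 : ℂ) • 1 ⊗ₜ ((E * F) ⊗ₜ (E * F * K))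
  - (1 + I) • 1 ⊗ₜ ((E * K) ⊗ₜ F)
  - (1 + I) • E ⊗ₜ ((F * K) ⊗ₜ 1)
  + (2 * I) • E ⊗ₜ ((E * F * K) ⊗ₜ F)
  + (1 - I) • (F * K) ⊗ₜ (E ⊗ₜ 1)
  - (2 * I) • (F * K) ⊗ₜ ((E * F * K) ⊗ₜ (E * K))
  - (2 : ℂ) • (E * F * K) ⊗ₜ ((E * F) ⊗ₜ 1)

/-- The component `Φ¹¹¹` of the coassociator. -/
def Phi111 (β : ℂ) : T3 Q :=
  (I * β ^ 2) •
    ((1 + I) • 1 ⊗ₜ (F ⊗ₜ (E * K))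
    - 1 ⊗ₜ (K ⊗ₜ 1)
    - (2 : ℂ) • 1 ⊗ₜ ((E * F) ⊗ₜ 1)
    - (2 * I) • 1 ⊗ₜ ((E * F) ⊗ₜ (E * F * K))
    + (1 + I) • 1 ⊗ₜ ((E * K) ⊗ₜ F)
    - (1 + I) • E ⊗ₜ (1 ⊗ₜ F)
    + (1 + I) • E ⊗ₜ ((F * K) ⊗ₜ 1)
    + (2 * I) • E ⊗ₜ ((F * K) ⊗ₜ (E * F * K))
    + (2 : ℂ) • E ⊗ₜ ((E * F * K) ⊗ₜ F)
    - (1 + I) • (F * K) ⊗ₜ (1 ⊗ₜ (E * K))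
    + (1 + I) • (F * K) ⊗ₜ (E ⊗ₜ 1)
    + (2 * I) • (F * K) ⊗ₜ (E ⊗ₜ (E * F * K))
    + (2 : ℂ) • (F * K) ⊗ₜ ((E * F * K) ⊗ₜ (E * K))
    + (2 * I) • (E * F * K) ⊗ₜ (F ⊗ₜ (E * K))
    + (2 * I) • (E * F * K) ⊗ₜ (K ⊗ₜ (E * F * K))
    - (2 * I) • (E * F * K) ⊗ₜ ((E * F) ⊗ₜ 1)
    + (2 * I) • (E * F * K) ⊗ₜ ((E * K) ⊗ₜ F)
    + (4 : ℂ) • (E * F * K) ⊗ₜ ((E * F) ⊗ₜ (E * F * K)))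

/-- The coassociator `Φ`. -/
def Phi (β : ℂ) : T3 Q :=
  e0 ⊗ₜ (e0 ⊗ₜ e0)
  + e1 ⊗ₜ (e0 ⊗ₜ e0)
  + Phi010 * e0 ⊗ₜ (e1 ⊗ₜ e0)
  + e0 ⊗ₜ (e0 ⊗ₜ e1)
  + e1 ⊗ₜ (e1 ⊗ₜ e0)
  + Phi101 * e1 ⊗ₜ (e0 ⊗ₜ e1)
  + e0 ⊗ₜ (e1 ⊗ₜ e1)
  + Phi111 β * e1 ⊗ₜ (e1 ⊗ₜ e1)

/-- The component `R⁰⁰` of the R-matrix. -/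
def R00 : Q ⊗[ℂ] Q :=
  (1 / 2 : ℂ) • (1 ⊗ₜ 1 + 1 ⊗ₜ K + K ⊗ₜ 1 - K ⊗ₜ K) *
    (1 ⊗ₜ 1 + (2 * I) • E ⊗ₜ F)

/-- The component `R⁰¹` of the R-matrix. -/
def R01 : Q ⊗[ℂ] Q :=
  (1 / 2 : ℂ) • (1 ⊗ₜ 1 - I • 1 ⊗ₜ K + K ⊗ₜ 1 + I • K ⊗ₜ K) *
    (1 ⊗ₜ 1
      + (1 - I) • (F * K) ⊗ₜ (E * K)
      - (1 - I) • E ⊗ₜ F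
      + (1 + I) • (E * F * K) ⊗ₜ 1
      + (2 * I) • (E * F * K) ⊗ₜ (E * F * K))

/-- The component `R¹⁰` of the R-matrix. -/
def R10 : Q ⊗[ℂ] Q :=
  (1 / 2 : ℂ) • (1 ⊗ₜ 1 + 1 ⊗ₜ K - I • K ⊗ₜ 1 + I • K ⊗ₜ K) *
    (1 ⊗ₜ K
      + (1 - I) • (F * K) ⊗ₜ E
      + (1 - I) • E ⊗ₜ (F * K)
      - (1 - I) • 1 ⊗ₜ (E * F)
      - (2 * I) • (E * F * K) ⊗ₜ (E * F))

/-- The component `R¹¹` of the R-matrix. -/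
def R11 (β : ℂ) : Q ⊗[ℂ] Q :=
  (β / 2) • (1 ⊗ₜ 1 - I • 1 ⊗ₜ K - I • K ⊗ₜ 1 + K ⊗ₜ K) *
    (-(I • K ⊗ₜ 1)
      + (2 * I) • (E * K) ⊗ₜ F
      + (1 - I) • K ⊗ₜ (E * F * K)
      - (1 + I) • (E * F) ⊗ₜ 1
      - (2 * I) • (E * F) ⊗ₜ (E * F * K))

/-- The R-matrix `R`. -/
def RMat (β : ℂ) : Q ⊗[ℂ] Q :=
  R00 * e0 ⊗ₜ e0 + R01 * e0 ⊗ₜ e1 + R10 * e1 ⊗ₜ e0 + R11 β * e1 ⊗ₜ e1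

/-- The standard R-matrix
`(1/2) ∑ (-1)^(mn) K^m ⊗ K^n (1 ⊗ 1 + 2i E ⊗ F)`, with `m, n` running over `0, 1`. -/
def RStandard : Q ⊗[ℂ] Q :=
  (1 / 2 : ℂ) • ∑ m ∈ Finset.range 2, ∑ n ∈ Finset.range 2,
    ((-1 : ℂ) ^ (m * n)) • (K ^ m) ⊗ₜ (K ^ n) * (1 ⊗ₜ 1 + (2 * I) • E ⊗ₜ F)

/-- The Casimir element `C = F E - (i/4) (K - K⁻¹)`. -/
def Casimir : Q := F * E - (I / 4) • (K - Kinv)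

end RestrictedSL2

end

/-!
Conjugating `Δ` by the inverse of `gauge` gives a comultiplication `fermionicComul` for which `E`
and `F` are primitive up to parity. It is coassociative only up to an element
`1 + (κ - 1) ⊗ e1 ⊗ e1` of the group algebra of `K`, whose pentagon identity reduces to `κ` being
grouplike, and its R-matrix is the product of a Cartan part and `1 - 2 E ⊗ g`, so the hexagon
identities reduce to identities in the group algebra of `K`. By Drinfeld's theorem, twisting a
quasi-triangular quasi-Hopf algebra gives another one; twisting back, it remains to compare `Φ`,
`R`, `α` and `β` with the twisted elements, one block of the idempotents `e0` and `e1` at a time.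
-/

noncomputable section

-- The instances on fourfold tensor powers are nested too deeply for the default depth.
set_option maxSynthPendingDepth 5

namespace QuasiHopf

section AlgHom

variable {A B : Type*} [Semiring A] [Semiring B] [Algebra ℂ A] [Algebra ℂ B]

/-- The homomorphism that an algebra homomorphism induces on groups of units. -/
abbrev mapUnits (f : A →ₐ[ℂ] B) : Aˣ →* Bˣ :=
  Units.map (f : A →* B)

theorem map_inv_mul_map (f : A →ₐ[ℂ] B) (u : Aˣ) : f ↑u⁻¹ * f u = 1 :=
  map_mul_eq_one f u.inv_mul

theorem map_mul_map_cancel_left (f : A →ₐ[ℂ] B) {x y : A} (h : x * y = 1) (z : B) :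
    f x * (f y * z) = z := by
  rw [← mul_assoc, map_mul_eq_one f h, one_mul]

theorem map_units_inv_eq_one (f : A →ₐ[ℂ] B) {u : Aˣ} (h : f u = 1) : f ↑u⁻¹ = 1 := by
  simpa only [h, mul_one] using map_inv_mul_map f u

/-- The inner automorphism `x ↦ u x u⁻¹`, as an algebra homomorphism. -/
def innerAlgHom {B : Type*} [Ring B] [Algebra ℂ B] (u : Bˣ) : B →ₐ[ℂ] B :=
  MulSemiringAction.toAlgHom ℂ B (ConjAct.toConjAct u)

theorem innerAlgHom_apply {B : Type*} [Ring B] [Algebra ℂ B] (u : Bˣ) (x : B) :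
    innerAlgHom u x = u * x * ↑u⁻¹ :=
  rfl

theorem tensor_hom_congr {f g : A ⊗[ℂ] A →ₐ[ℂ] B} (h : ∀ x y, f (x ⊗ₜ y) = g (x ⊗ₜ y))
    (X : A ⊗[ℂ] A) : f X = g X :=
  DFunLike.congr_fun (Algebra.TensorProduct.ext' h) X

end AlgHom

variable {A : Type} [Ring A] [Algebra ℂ A] {Δ : A →ₐ[ℂ] A ⊗[ℂ] A}

section TensorPowers

theorem flip_tmul (x y : A) : flip (x ⊗ₜ[ℂ] y) = y ⊗ₜ x :=
  rfl

theorem legs_tmul (x y : A) :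
    leg12 (x ⊗ₜ y) = (x ⊗ₜ (y ⊗ₜ 1) : T3 A) ∧
    leg13 (x ⊗ₜ y) = (x ⊗ₜ (1 ⊗ₜ y) : T3 A) ∧
    leg23 (x ⊗ₜ y) = (1 ⊗ₜ (x ⊗ₜ y) : T3 A) :=
  ⟨rfl, rfl, rfl⟩

theorem perm231_tmul (x y z : A) : perm231 (x ⊗ₜ (y ⊗ₜ z)) = (y ⊗ₜ (z ⊗ₜ x) : T3 A) :=
  rfl

theorem tensor_induction₃ {p : T3 A → Prop} (tmul : ∀ x y z, p (x ⊗ₜ (y ⊗ₜ z)))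
    (add : ∀ X Y, p X → p Y → p (X + Y)) (X : T3 A) : p X := by
  have zero : p 0 := by simpa using tmul 0 0 0
  induction X using TensorProduct.induction_on with
  | zero => exact zero
  | add X Y hX hY => exact add X Y hX hY
  | tmul x Y =>
    induction Y using TensorProduct.induction_on with
    | zero => simpa using zero
    | add Y Z hY hZ => simpa only [TensorProduct.tmul_add] using add _ _ hY hZ
    | tmul y z => exact tmul x y z

theorem tmul_mul_left_comm {a b c : A} (ha : ∀ x, Commute a x) (hb : ∀ x, Commute b x)
    (hc : ∀ x, Commute c x) (W Z : T3 A) :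
    a ⊗ₜ (b ⊗ₜ c) * (W * Z) = W * (a ⊗ₜ (b ⊗ₜ c) * Z) := by
  have h : Commute (a ⊗ₜ (b ⊗ₜ c)) W := by
    induction W using tensor_induction₃ with
    | tmul x y z => simp [commute_iff_eq, (ha x).eq, (hb y).eq, (hc z).eq]
    | add X Y hX hY => exact hX.add_right hY
  exact h.left_comm Z

theorem commute_leg12_one_tmul (X : A ⊗[ℂ] A) (y : A) :
    Commute (leg12 X) (1 ⊗ₜ (1 ⊗ₜ y)) := by
  induction X using TensorProduct.induction_on with
  | zero => simp
  | add X X' h h' => simpa only [map_add] using h.add_left h'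
  | tmul u v => simp [leg12, commute_iff_eq]

theorem commute_tensorOne_one_tmul (X : T3 A) (y : A) :
    Commute (tensorOne X : T4 A) (1 ⊗ₜ (1 ⊗ₜ (1 ⊗ₜ y))) := by
  induction X using tensor_induction₃ with
  | add X X' h h' => simpa only [map_add] using h.add_left h'
  | tmul u v w => simp [commute_iff_eq, tensorOne]

theorem commute_tensorOne_leg12_oneTensor_leg23 (X Y : A ⊗[ℂ] A) :
    Commute (tensorOne (leg12 X) : T4 A) (oneTensor (leg23 Y)) := by
  induction X using TensorProduct.induction_on with
  | zero => simp
  | add X X' h h' => simpa only [map_add] using h.add_left h'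
  | tmul u v =>
    simp [leg12, leg23, tensorOne, oneTensor, ← Algebra.TensorProduct.one_def, commute_iff_eq]

theorem idComul_tmul (x y : A) : idComul Δ (x ⊗ₜ y) = x ⊗ₜ 1 * leg23 (Δ y) := by
  simp [idComul, leg23]

theorem comulId_tmul (x y : A) : comulId Δ (x ⊗ₜ y) = leg12 (Δ x) * 1 ⊗ₜ (1 ⊗ₜ y) := by
  change Algebra.TensorProduct.assoc ℂ ℂ ℂ A A A (Δ x ⊗ₜ y) = _
  induction Δ x using TensorProduct.induction_on with
  | zero => simp
  | add X Y hX hY => simp only [map_add, hX, hY, TensorProduct.add_tmul, add_mul]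
  | tmul u v => simp [leg12]

theorem comulIdId_tmul (x : A) (Y : A ⊗[ℂ] A) :
    comulIdId Δ (x ⊗ₜ Y) = tensorOne (leg12 (Δ x)) * 1 ⊗ₜ (1 ⊗ₜ Y) := by
  change Algebra.TensorProduct.assoc ℂ ℂ ℂ A A (A ⊗[ℂ] A) (Δ x ⊗ₜ Y) = _
  induction Δ x using TensorProduct.induction_on with
  | zero => simp
  | add X Y hX hY => simp only [map_add, hX, hY, TensorProduct.add_tmul, add_mul]
  | tmul u v => simp [leg12, tensorOne, ← Algebra.TensorProduct.one_def]

theorem comulIdId_leg12 (X : A ⊗[ℂ] A) : comulIdId Δ (leg12 X) = tensorOne (comulId Δ X) := by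
  refine tensor_hom_congr (f := (comulIdId Δ).comp leg12) (g := tensorOne.comp (comulId Δ))
    (fun x y => ?_) X
  have hone : (tensorOne ((1 : A) ⊗ₜ[ℂ] ((1 : A) ⊗ₜ[ℂ] y)) : T4 A) =
    1 ⊗ₜ (1 ⊗ₜ (y ⊗ₜ 1)) := rfl
  simp only [AlgHom.comp_apply, legs_tmul, comulIdId_tmul, comulId_tmul, map_mul, hone]

theorem comulIdId_leg23 (X : A ⊗[ℂ] A) : comulIdId Δ (leg23 X) = oneTensor (leg23 X) := by
  simp [leg23, oneTensor, comulIdId_tmul]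

theorem idIdComul_leg12 (X : A ⊗[ℂ] A) : idIdComul Δ (leg12 X) = tensorOne (leg12 X) := by
  refine tensor_hom_congr (f := (idIdComul Δ).comp leg12) (g := tensorOne.comp leg12)
    (fun x y => ?_) X
  simp [leg12, idIdComul, idComul, tensorOne, Algebra.TensorProduct.one_def]

theorem idIdComul_leg23 (X : A ⊗[ℂ] A) : idIdComul Δ (leg23 X) = oneTensor (idComul Δ X) := by
  simp [leg23, idIdComul, oneTensor]

theorem idComulId_leg12 (X : A ⊗[ℂ] A) : idComulId Δ (leg12 X) = tensorOne (idComul Δ X) := by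
  refine tensor_hom_congr (f := (idComulId Δ).comp leg12) (g := tensorOne.comp (idComul Δ))
    (fun x y => ?_) X
  simp [leg12, idComulId, comulId_tmul, tensorOne, idComul, ← Algebra.TensorProduct.one_def]

theorem idComulId_leg23 (X : A ⊗[ℂ] A) : idComulId Δ (leg23 X) = oneTensor (comulId Δ X) := by
  simp [leg23, idComulId, oneTensor]

theorem tensorOne_leg23 (X : A ⊗[ℂ] A) :
    (tensorOne (leg23 X) : T4 A) = oneTensor (leg12 X) := by
  simp [leg23, leg12, tensorOne, oneTensor]

theorem comulIdId_idComul (X : A ⊗[ℂ] A) :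
    comulIdId Δ (idComul Δ X) = idIdComul Δ (comulId Δ X) := by
  refine tensor_hom_congr (f := (comulIdId Δ).comp (idComul Δ))
    (g := (idIdComul Δ).comp (comulId Δ)) (fun x y => ?_) X
  simp only [AlgHom.comp_apply, comulId_tmul, map_mul, idIdComul_leg12]
  simp [idComul, idIdComul, comulIdId_tmul]

end TensorPowers

section Permutations

theorem perm132_leg12 (X : A ⊗[ℂ] A) : perm132 (leg12 X) = leg13 X :=
  tensor_hom_congr (f := perm132.comp leg12) (g := leg13) (fun _ _ => rfl) X

theorem perm132_leg13 (X : A ⊗[ℂ] A) : perm132 (leg13 X) = leg12 X :=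
  tensor_hom_congr (f := perm132.comp leg13) (g := leg12) (fun _ _ => rfl) X

theorem perm132_leg23 (X : A ⊗[ℂ] A) : perm132 (leg23 X) = leg23 (flip X) :=
  rfl

theorem perm213_leg12 (X : A ⊗[ℂ] A) : perm213 (leg12 X) = leg12 (flip X) :=
  tensor_hom_congr (f := perm213.comp leg12) (g := leg12.comp flip) (fun _ _ => rfl) X

theorem perm213_leg13 (X : A ⊗[ℂ] A) : perm213 (leg13 X) = leg23 X :=
  tensor_hom_congr (f := perm213.comp leg13) (g := leg23) (fun _ _ => rfl) X

theorem perm213_leg23 (X : A ⊗[ℂ] A) : perm213 (leg23 X) = leg13 X :=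
  tensor_hom_congr (f := perm213.comp leg23) (g := leg13) (fun _ _ => rfl) X

theorem perm231_leg12 (X : A ⊗[ℂ] A) : perm231 (leg12 X) = leg13 (flip X) := by
  simp only [perm231, AlgHom.comp_apply, perm213_leg12, perm132_leg12]

theorem perm231_leg23 (X : A ⊗[ℂ] A) : perm231 (leg23 X) = leg12 X := by
  simp only [perm231, AlgHom.comp_apply, perm213_leg23, perm132_leg13]

theorem perm312_leg12 (X : A ⊗[ℂ] A) : perm312 (leg12 X) = leg23 X := by
  simp only [perm312, AlgHom.comp_apply, perm132_leg12, perm213_leg13]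

theorem perm312_leg23 (X : A ⊗[ℂ] A) : perm312 (leg23 X) = leg13 (flip X) := by
  simp only [perm312, AlgHom.comp_apply, perm132_leg23, perm213_leg23]

theorem perm231_idComul (X : A ⊗[ℂ] A) : perm231 (idComul Δ X) = comulId Δ (flip X) := by
  refine tensor_hom_congr (f := perm231.comp (idComul Δ)) (g := (comulId Δ).comp flip)
    (fun x y => ?_) X
  have hcomm : (x ⊗ₜ 1 * leg23 (Δ y) : T3 A) = leg23 (Δ y) * x ⊗ₜ 1 := by simp [leg23]
  have hx : perm231 (x ⊗ₜ 1 : T3 A) = 1 ⊗ₜ (1 ⊗ₜ x) := rfl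
  simp only [AlgHom.comp_apply, idComul_tmul, hcomm, map_mul, perm231_leg23, hx, flip_tmul,
    comulId_tmul]

theorem perm312_comulId (X : A ⊗[ℂ] A) : perm312 (comulId Δ X) = idComul Δ (flip X) := by
  refine tensor_hom_congr (f := perm312.comp (comulId Δ)) (g := (idComul Δ).comp flip)
    (fun x y => ?_) X
  have hy : perm312 (1 ⊗ₜ (1 ⊗ₜ y) : T3 A) = y ⊗ₜ 1 := rfl
  simp [comulId_tmul, perm312_leg12, flip, idComul, leg23, hy]

end Permutations

section Coassociator

variable (Δ) in
/-- The comultiplication `a ↦ J Δ(a) J⁻¹` obtained from `Δ` by the gauge transformation `J`. -/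
def twistComul (J : (A ⊗[ℂ] A)ˣ) : A →ₐ[ℂ] A ⊗[ℂ] A :=
  (innerAlgHom J).comp Δ

theorem twistComul_apply (J : (A ⊗[ℂ] A)ˣ) (a : A) : twistComul Δ J a = J * Δ a * ↑J⁻¹ :=
  rfl

theorem twistComul_inv_twistComul (J : (A ⊗[ℂ] A)ˣ) : twistComul (twistComul Δ J⁻¹) J = Δ := by
  ext a
  simp [twistComul_apply, mul_assoc]

theorem twistComul_inv_apply_eq {J : (A ⊗[ℂ] A)ˣ} {a : A} {Y : A ⊗[ℂ] A} (h : Δ a * J = J * Y) :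
    twistComul Δ J⁻¹ a = Y := by
  rw [twistComul_apply, inv_inv, mul_assoc, h, Units.inv_mul_cancel_left]

theorem comulId_twistComul (J : (A ⊗[ℂ] A)ˣ) (X : A ⊗[ℂ] A) :
    comulId (twistComul Δ J) X = innerAlgHom (mapUnits leg12 J) (comulId Δ X) := by
  refine tensor_hom_congr (f := comulId (twistComul Δ J))
    (g := (innerAlgHom (mapUnits leg12 J)).comp (comulId Δ)) (fun x y => ?_) X
  have hcomm := commute_leg12_one_tmul (↑J⁻¹ : A ⊗[ℂ] A) y
  simp [innerAlgHom_apply, comulId_tmul, twistComul_apply, mul_assoc, hcomm.eq]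

theorem idComul_twistComul (J : (A ⊗[ℂ] A)ˣ) (X : A ⊗[ℂ] A) :
    idComul (twistComul Δ J) X = innerAlgHom (mapUnits leg23 J) (idComul Δ X) := by
  refine tensor_hom_congr (f := idComul (twistComul Δ J))
    (g := (innerAlgHom (mapUnits leg23 J)).comp (idComul Δ)) (fun x y => ?_) X
  simp [innerAlgHom_apply, idComul, leg23, twistComul_apply]

theorem comulIdId_twistComul (J : (A ⊗[ℂ] A)ˣ) (X : T3 A) :
    comulIdId (twistComul Δ J) X =
      innerAlgHom (mapUnits tensorOne (mapUnits leg12 J)) (comulIdId Δ X) := by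
  refine DFunLike.congr_fun (Algebra.TensorProduct.ext' (g := comulIdId (twistComul Δ J))
    (h := (innerAlgHom (mapUnits tensorOne (mapUnits leg12 J))).comp (comulIdId Δ))
    (fun x Y => ?_)) X
  have hcomm : Commute (tensorOne (leg12 (↑J⁻¹ : A ⊗[ℂ] A)) : T4 A) (1 ⊗ₜ (1 ⊗ₜ Y)) :=
    commute_tensorOne_leg12_oneTensor_leg23 _ Y
  simp [innerAlgHom_apply, comulIdId_tmul, twistComul_apply, mul_assoc, hcomm.eq]

theorem idComulId_twistComul (J : (A ⊗[ℂ] A)ˣ) (X : T3 A) :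
    idComulId (twistComul Δ J) X =
      innerAlgHom (mapUnits tensorOne (mapUnits leg23 J)) (idComulId Δ X) := by
  refine DFunLike.congr_fun (Algebra.TensorProduct.ext' (g := idComulId (twistComul Δ J))
    (h := (innerAlgHom (mapUnits tensorOne (mapUnits leg23 J))).comp (idComulId Δ))
    (fun x Y => ?_)) X
  simp [innerAlgHom_apply, idComulId, comulId_twistComul, tensorOne_leg23, oneTensor]

theorem idIdComul_twistComul (J : (A ⊗[ℂ] A)ˣ) (X : T3 A) :
    idIdComul (twistComul Δ J) X =
      innerAlgHom (mapUnits oneTensor (mapUnits leg23 J)) (idIdComul Δ X) := by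
  refine DFunLike.congr_fun (Algebra.TensorProduct.ext' (g := idIdComul (twistComul Δ J))
    (h := (innerAlgHom (mapUnits oneTensor (mapUnits leg23 J))).comp (idIdComul Δ))
    (fun x Y => ?_)) X
  simp [innerAlgHom_apply, idIdComul, idComul_twistComul, oneTensor]

variable (Δ) in
/-- The coassociator obtained from `Φ` by the gauge transformation `J`. -/
def twistCoassociator (Φ : (T3 A)ˣ) (J : (A ⊗[ℂ] A)ˣ) : (T3 A)ˣ :=
  mapUnits leg12 J * mapUnits (comulId Δ) J * Φ * (mapUnits (idComul Δ) J)⁻¹ *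
    (mapUnits leg23 J)⁻¹

theorem coe_twistCoassociator_eq_iff {Φ : (T3 A)ˣ} {J : (A ⊗[ℂ] A)ˣ} {Ψ : T3 A} :
    (twistCoassociator Δ Φ J : T3 A) = Ψ ↔
      leg12 (J : A ⊗[ℂ] A) * (comulId Δ (J : A ⊗[ℂ] A) * Φ) =
        Ψ * (leg23 (J : A ⊗[ℂ] A) * idComul Δ (J : A ⊗[ℂ] A)) := by
  rw [twistCoassociator, Units.val_mul, Units.mul_inv_eq_iff_eq_mul, Units.val_mul,
    Units.mul_inv_eq_iff_eq_mul, mul_assoc Ψ, Units.val_mul, Units.val_mul, mul_assoc]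
  rfl

variable {Φ : (T3 A)ˣ} (h : ∀ a, comulId Δ (Δ a) = innerAlgHom Φ (idComul Δ (Δ a)))
include h

theorem twistComul_quasi_coassoc (J : (A ⊗[ℂ] A)ˣ) (a : A) :
    comulId (twistComul Δ J) (twistComul Δ J a) =
      innerAlgHom (twistCoassociator Δ Φ J) (idComul (twistComul Δ J) (twistComul Δ J a)) := by
  simp [comulId_twistComul, idComul_twistComul, twistComul_apply, innerAlgHom_apply,
    twistCoassociator, mul_assoc, h, map_mul_map_cancel_left]

theorem comulIdId_comulId (X : A ⊗[ℂ] A) :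
    comulIdId Δ (comulId Δ X) =
      innerAlgHom (mapUnits tensorOne Φ) (idComulId Δ (comulId Δ X)) := by
  refine tensor_hom_congr (f := (comulIdId Δ).comp (comulId Δ))
    (g := (innerAlgHom (mapUnits tensorOne Φ)).comp ((idComulId Δ).comp (comulId Δ)))
    (fun x y => ?_) X
  have hcomm := commute_tensorOne_one_tmul (↑Φ⁻¹ : T3 A) y
  have hy : comulIdId Δ (1 ⊗ₜ (1 ⊗ₜ y)) = 1 ⊗ₜ (1 ⊗ₜ (1 ⊗ₜ y)) := by
    simp [comulIdId_tmul]
  have hy' : idComulId Δ (1 ⊗ₜ (1 ⊗ₜ y)) = 1 ⊗ₜ (1 ⊗ₜ (1 ⊗ₜ y)) := by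
    simp [idComulId, comulId_tmul]
  simp [comulId_tmul, comulIdId_leg12, idComulId_leg12, h, innerAlgHom_apply, mul_assoc, hy, hy',
    hcomm.eq]

theorem idComulId_idComul (X : A ⊗[ℂ] A) :
    idComulId Δ (idComul Δ X) =
      innerAlgHom (mapUnits oneTensor Φ) (idIdComul Δ (idComul Δ X)) := by
  refine tensor_hom_congr (f := (idComulId Δ).comp (idComul Δ))
    (g := (innerAlgHom (mapUnits oneTensor Φ)).comp ((idIdComul Δ).comp (idComul Δ)))
    (fun x y => ?_) X
  simp [idComul, idComulId, idIdComul, h, innerAlgHom_apply, oneTensor]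

theorem twistCoassociator_cocycle
    (hΦ : comulIdId Δ (Φ : T3 A) * idIdComul Δ (Φ : T3 A) =
      tensorOne (Φ : T3 A) * idComulId Δ (Φ : T3 A) * oneTensor (Φ : T3 A))
    (J : (A ⊗[ℂ] A)ˣ) :
    comulIdId (twistComul Δ J) (twistCoassociator Δ Φ J : T3 A) *
        idIdComul (twistComul Δ J) (twistCoassociator Δ Φ J : T3 A) =
      tensorOne (twistCoassociator Δ Φ J : T3 A) *
        idComulId (twistComul Δ J) (twistCoassociator Δ Φ J : T3 A) *
        oneTensor (twistCoassociator Δ Φ J : T3 A) := by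
  have hcomm (Z : T4 A) :=
    (commute_tensorOne_leg12_oneTensor_leg23 (↑J⁻¹ : A ⊗[ℂ] A) J).left_comm Z
  have hΦ' (Z : T4 A) :
      tensorOne (↑Φ⁻¹ : T3 A) * (comulIdId Δ (Φ : T3 A) * (idIdComul Δ (Φ : T3 A) * Z)) =
        idComulId Δ (Φ : T3 A) * (oneTensor (Φ : T3 A) * Z) := by
    rw [← mul_assoc (comulIdId Δ _), hΦ]
    simp only [mul_assoc, map_mul_map_cancel_left, Units.inv_mul]
  simp only [comulIdId_twistComul, idIdComul_twistComul, idComulId_twistComul]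
  simp only [innerAlgHom_apply, twistCoassociator, Units.val_mul, Units.coe_map,
    MonoidHom.coe_coe, ← map_inv, map_mul, mul_assoc, comulIdId_leg12, comulIdId_leg23,
    idComulId_leg12, idComulId_leg23, idIdComul_leg12, idIdComul_leg23, comulIdId_idComul,
    tensorOne_leg23, comulIdId_comulId h, idComulId_idComul h,
    map_mul_map_cancel_left, map_inv_mul_map, hcomm, hΦ', Units.inv_mul]

end Coassociator

section RMatrix

variable {Φ : (T3 A)ˣ} {R : (A ⊗[ℂ] A)ˣ}

/-- The R-matrix obtained from `R` by the gauge transformation `J`. -/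
def twistRMatrix (R J : (A ⊗[ℂ] A)ˣ) : (A ⊗[ℂ] A)ˣ :=
  mapUnits flip J * R * J⁻¹

theorem coe_twistRMatrix_eq_iff {J : (A ⊗[ℂ] A)ˣ} {X : A ⊗[ℂ] A} :
    (twistRMatrix R J : A ⊗[ℂ] A) = X ↔ flip (J : A ⊗[ℂ] A) * R = X * J := by
  rw [twistRMatrix, Units.val_mul, Units.mul_inv_eq_iff_eq_mul]
  rfl

variable (hR : ∀ a, (R : A ⊗[ℂ] A) * Δ a = flip (Δ a) * (R : A ⊗[ℂ] A))
include hR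

theorem leg12_mul_comulId (X : A ⊗[ℂ] A) :
    leg12 (R : A ⊗[ℂ] A) * comulId Δ X = perm213 (comulId Δ X) * leg12 (R : A ⊗[ℂ] A) := by
  induction X using TensorProduct.induction_on with
  | zero => simp
  | add X Y hX hY => simp only [map_add, mul_add, add_mul, hX, hY]
  | tmul x y =>
    have hy : perm213 (1 ⊗ₜ (1 ⊗ₜ y) : T3 A) = 1 ⊗ₜ (1 ⊗ₜ y) := rfl
    have hcomm := (commute_leg12_one_tmul (R : A ⊗[ℂ] A) y).eq
    rw [comulId_tmul, ← mul_assoc, ← map_mul, hR, map_mul, map_mul, perm213_leg12, mul_assoc,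
      hcomm, mul_assoc, hy]

theorem leg23_mul_idComul (X : A ⊗[ℂ] A) :
    leg23 (R : A ⊗[ℂ] A) * idComul Δ X = perm132 (idComul Δ X) * leg23 (R : A ⊗[ℂ] A) := by
  induction X using TensorProduct.induction_on with
  | zero => simp
  | add X Y hX hY => simp only [map_add, mul_add, add_mul, hX, hY]
  | tmul x y => simp [leg23, perm132, idComul, hR]

theorem leg13_mul_perm132_comulId (X : A ⊗[ℂ] A) :
    leg13 (R : A ⊗[ℂ] A) * perm132 (comulId Δ X) =
      perm231 (comulId Δ X) * leg13 (R : A ⊗[ℂ] A) := by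
  simpa only [map_mul, perm132_leg12, perm231, AlgHom.comp_apply]
    using congrArg perm132 (leg12_mul_comulId hR X)

theorem leg13_mul_perm213_idComul (X : A ⊗[ℂ] A) :
    leg13 (R : A ⊗[ℂ] A) * perm213 (idComul Δ X) =
      perm312 (idComul Δ X) * leg13 (R : A ⊗[ℂ] A) := by
  simpa only [map_mul, perm213_leg23, perm312, AlgHom.comp_apply]
    using congrArg perm213 (leg23_mul_idComul hR X)

theorem twistRMatrix_mul_twistComul (J : (A ⊗[ℂ] A)ˣ) (a : A) :
    (twistRMatrix R J : A ⊗[ℂ] A) * twistComul Δ J a =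
      flip (twistComul Δ J a) * (twistRMatrix R J : A ⊗[ℂ] A) := by
  have hR' (Z : A ⊗[ℂ] A) : R * (Δ a * Z) = flip (Δ a) * (R * Z) := by
    rw [← mul_assoc, hR, mul_assoc]
  simp [twistRMatrix, twistComul_apply, hR', mul_assoc, map_mul_map_cancel_left]

theorem comulId_twistRMatrix
    (h : comulId Δ (R : A ⊗[ℂ] A) = perm231 (↑Φ⁻¹ : T3 A) * leg13 (R : A ⊗[ℂ] A) *
      perm132 (Φ : T3 A) * leg23 (R : A ⊗[ℂ] A) * (↑Φ⁻¹ : T3 A))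
    (J : (A ⊗[ℂ] A)ˣ) :
    comulId (twistComul Δ J) (twistRMatrix R J : A ⊗[ℂ] A) =
      perm231 (↑(twistCoassociator Δ Φ J)⁻¹ : T3 A) * leg13 (twistRMatrix R J : A ⊗[ℂ] A) *
        perm132 (twistCoassociator Δ Φ J : T3 A) * leg23 (twistRMatrix R J : A ⊗[ℂ] A) *
        (↑(twistCoassociator Δ Φ J)⁻¹ : T3 A) := by
  have h13 (Z : T3 A) : leg13 (R : A ⊗[ℂ] A) * (perm132 (comulId Δ J) * Z) =
      perm231 (comulId Δ J) * (leg13 (R : A ⊗[ℂ] A) * Z) := by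
    rw [← mul_assoc, leg13_mul_perm132_comulId hR, mul_assoc]
  have h23 (Z : T3 A) : leg23 (R : A ⊗[ℂ] A) * (idComul Δ J * Z) =
      perm132 (idComul Δ J) * (leg23 (R : A ⊗[ℂ] A) * Z) := by
    rw [← mul_assoc, leg23_mul_idComul hR, mul_assoc]
  simp only [twistRMatrix, twistCoassociator, comulId_twistComul, innerAlgHom_apply, mul_inv_rev,
    inv_inv, Units.val_mul, Units.coe_map, Units.coe_map_inv, MonoidHom.coe_coe, map_mul,
    mul_assoc, perm231_leg12, perm231_leg23, perm231_idComul, perm132_leg12, perm132_leg23,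
    map_mul_map_cancel_left, map_inv_mul_map, Units.inv_mul, h13, h23, h]

theorem idComul_twistRMatrix
    (h : idComul Δ (R : A ⊗[ℂ] A) = perm312 (Φ : T3 A) * leg13 (R : A ⊗[ℂ] A) *
      perm213 (↑Φ⁻¹ : T3 A) * leg12 (R : A ⊗[ℂ] A) * (Φ : T3 A))
    (J : (A ⊗[ℂ] A)ˣ) :
    idComul (twistComul Δ J) (twistRMatrix R J : A ⊗[ℂ] A) =
      perm312 (twistCoassociator Δ Φ J : T3 A) * leg13 (twistRMatrix R J : A ⊗[ℂ] A) *
        perm213 (↑(twistCoassociator Δ Φ J)⁻¹ : T3 A) * leg12 (twistRMatrix R J : A ⊗[ℂ] A) *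
        (twistCoassociator Δ Φ J : T3 A) := by
  have h13 (Z : T3 A) : leg13 (R : A ⊗[ℂ] A) * (perm213 (idComul Δ J) * Z) =
      perm312 (idComul Δ J) * (leg13 (R : A ⊗[ℂ] A) * Z) := by
    rw [← mul_assoc, leg13_mul_perm213_idComul hR, mul_assoc]
  have h12 (Z : T3 A) : leg12 (R : A ⊗[ℂ] A) * (comulId Δ J * Z) =
      perm213 (comulId Δ J) * (leg12 (R : A ⊗[ℂ] A) * Z) := by
    rw [← mul_assoc, leg12_mul_comulId hR, mul_assoc]
  simp only [twistRMatrix, twistCoassociator, idComul_twistComul, innerAlgHom_apply, mul_inv_rev,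
    inv_inv, Units.val_mul, Units.coe_map, Units.coe_map_inv, MonoidHom.coe_coe, map_mul,
    mul_assoc, perm312_leg12, perm312_leg23, perm312_comulId, perm213_leg12, perm213_leg23,
    map_mul_map_cancel_left, map_inv_mul_map, Units.inv_mul, h13, h12, h]

end RMatrix

section Counit

variable {A : Type} [Ring A] [Algebra ℂ A] {Δ : A →ₐ[ℂ] A ⊗[ℂ] A} {ε : A →ₐ[ℂ] ℂ}

/-- `ε ⊗ id : A ⊗ A → A`. -/
def counitId (ε : A →ₐ[ℂ] ℂ) : A ⊗[ℂ] A →ₐ[ℂ] A :=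
  (Algebra.TensorProduct.lid ℂ A).toAlgHom.comp (Algebra.TensorProduct.map ε (AlgHom.id ℂ A))

/-- `id ⊗ ε : A ⊗ A → A`. -/
def idCounit (ε : A →ₐ[ℂ] ℂ) : A ⊗[ℂ] A →ₐ[ℂ] A :=
  (Algebra.TensorProduct.rid ℂ ℂ A).toAlgHom.comp (Algebra.TensorProduct.map (AlgHom.id ℂ A) ε)

theorem counitId_tmul (x y : A) : counitId ε (x ⊗ₜ y) = ε x • y := by
  simp [counitId]

theorem idCounit_tmul (x y : A) : idCounit ε (x ⊗ₜ y) = ε y • x := by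
  simp [idCounit]

theorem counitId_comulAlgHom {A : Type} [Ring A] [Bialgebra ℂ A] (a : A) :
    counitId (Bialgebra.counitAlgHom ℂ A) (Bialgebra.comulAlgHom ℂ A a) = a :=
  (congrArg (TensorProduct.lid ℂ A) (Coalgebra.rTensor_counit_comul (R := ℂ) a)).trans (by simp)

theorem idCounit_comulAlgHom {A : Type} [Ring A] [Bialgebra ℂ A] (a : A) :
    idCounit (Bialgebra.counitAlgHom ℂ A) (Bialgebra.comulAlgHom ℂ A a) = a :=
  (congrArg (TensorProduct.rid ℂ A) (Coalgebra.lTensor_counit_comul (R := ℂ) a)).trans (by simp)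

theorem idCounitId_leg12 (X : A ⊗[ℂ] A) : idCounitId ε (leg12 X) = idCounit ε X ⊗ₜ 1 := by
  refine tensor_hom_congr (f := (idCounitId ε).comp leg12)
    (g := Algebra.TensorProduct.includeLeft.comp (idCounit ε)) (fun x y => ?_) X
  simp [idCounitId, leg12, idCounit_tmul, TensorProduct.smul_tmul']

theorem idCounitId_leg23 (X : A ⊗[ℂ] A) : idCounitId ε (leg23 X) = 1 ⊗ₜ counitId ε X := by
  simp [idCounitId, leg23, counitId]

theorem idCounitId_idComul (h : ∀ a, counitId ε (Δ a) = a) (X : A ⊗[ℂ] A) :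
    idCounitId ε (idComul Δ X) = X :=
  tensor_hom_congr (f := (idCounitId ε).comp (idComul Δ)) (g := AlgHom.id ℂ _)
    (fun x y => congrArg (x ⊗ₜ ·) (h y)) X

theorem idCounitId_comulId (h : ∀ a, idCounit ε (Δ a) = a) (X : A ⊗[ℂ] A) :
    idCounitId ε (comulId Δ X) = X := by
  refine tensor_hom_congr (f := (idCounitId ε).comp (comulId Δ)) (g := AlgHom.id ℂ _)
    (fun x y => ?_) X
  have hy : idCounitId ε ((1 : A) ⊗ₜ ((1 : A) ⊗ₜ y)) = 1 ⊗ₜ y := by simp [idCounitId]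
  simp [comulId_tmul, idCounitId_leg12, h, hy]

/-- A gauge transformation: an invertible `J` with `(ε ⊗ id)(J) = 1 = (id ⊗ ε)(J)`. -/
structure IsCounital (ε : A →ₐ[ℂ] ℂ) (J : (A ⊗[ℂ] A)ˣ) : Prop where
  counitId : counitId ε J = 1
  idCounit : idCounit ε J = 1

variable {J : (A ⊗[ℂ] A)ˣ} (hJ : IsCounital ε J)
include hJ

theorem IsCounital.inv : IsCounital ε J⁻¹ :=
  ⟨map_units_inv_eq_one _ hJ.counitId, map_units_inv_eq_one _ hJ.idCounit⟩

theorem IsCounital.counitId_twistComul (h : ∀ a, QuasiHopf.counitId ε (Δ a) = a) (a : A) :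
    QuasiHopf.counitId ε (twistComul Δ J a) = a := by
  simp only [twistComul_apply, map_mul, hJ.counitId, hJ.inv.counitId, h, one_mul, mul_one]

theorem IsCounital.idCounit_twistComul (h : ∀ a, QuasiHopf.idCounit ε (Δ a) = a) (a : A) :
    QuasiHopf.idCounit ε (twistComul Δ J a) = a := by
  simp only [twistComul_apply, map_mul, hJ.idCounit, hJ.inv.idCounit, h, one_mul, mul_one]

end Counit

section Sandwich

variable {A : Type} [Ring A] [Algebra ℂ A]

theorem sandwich₂_tmul (f g : A →ₗ[ℂ] A) (c x y : A) :
    sandwich₂ f c g (x ⊗ₜ y) = f x * c * g y := by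
  simp [sandwich₂, mul_assoc]

theorem sandwich₃_tmul (f g h : A →ₗ[ℂ] A) (c d x y z : A) :
    sandwich₃ f c g d h (x ⊗ₜ (y ⊗ₜ z)) = f x * c * g y * d * h z := by
  simp [sandwich₃, sandwich₂, mul_assoc]

theorem smul_sandwich₂ (f g : A →ₗ[ℂ] A) (r : ℂ) (c : A) (X : A ⊗[ℂ] A) :
    sandwich₂ f (r • c) g X = r • sandwich₂ f c g X := by
  induction X using TensorProduct.induction_on with
  | zero => simp
  | add X Y hX hY => simp only [map_add, smul_add, hX, hY]
  | tmul x y => simp [sandwich₂_tmul]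

theorem smul_sandwich₃ (f g h : A →ₗ[ℂ] A) (r : ℂ) (c d : A) (X : T3 A) :
    sandwich₃ f (r • c) g d h X = r • sandwich₃ f c g d h X := by
  induction X using tensor_induction₃ with
  | add X Y hX hY => simp only [map_add, smul_add, hX, hY]
  | tmul x y z => simp [sandwich₃_tmul]

theorem sandwich₃_smul (f g h : A →ₗ[ℂ] A) (r : ℂ) (c d : A) (X : T3 A) :
    sandwich₃ f c g (r • d) h X = r • sandwich₃ f c g d h X := by
  induction X using tensor_induction₃ with
  | add X Y hX hY => simp only [map_add, smul_add, hX, hY]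
  | tmul x y z => simp [sandwich₃_tmul]

theorem sandwich₃_tmul_one_mul (f g : A →ₗ[ℂ] A) (c d x : A) (X : T3 A) :
    sandwich₃ LinearMap.id c f d g (x ⊗ₜ 1 * X) = x * sandwich₃ LinearMap.id c f d g X := by
  induction X using tensor_induction₃ with
  | add X Y hX hY => simp only [map_add, mul_add, hX, hY]
  | tmul u v w => simp [sandwich₃_tmul, mul_assoc]

theorem sandwich₃_mul_one_tmul (f g : A →ₗ[ℂ] A) (c d x : A) (X : T3 A) :
    sandwich₃ f c g d LinearMap.id (X * 1 ⊗ₜ (1 ⊗ₜ x)) =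
      sandwich₃ f c g d LinearMap.id X * x := by
  induction X using tensor_induction₃ with
  | add X Y hX hY => simp only [map_add, add_mul, hX, hY]
  | tmul u v w => simp [sandwich₃_tmul, mul_assoc]

theorem sandwich₂_antipode_comul {A : Type} [Ring A] [HopfAlgebra ℂ A] (a : A) :
    sandwich₂ (HopfAlgebra.antipode ℂ) 1 LinearMap.id (Bialgebra.comulAlgHom ℂ A a) =
      Bialgebra.counitAlgHom ℂ A a • 1 := by
  have h : sandwich₂ (HopfAlgebra.antipode ℂ) (1 : A) LinearMap.id =
      LinearMap.mul' ℂ A ∘ₗ (HopfAlgebra.antipode ℂ).rTensor A :=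
    TensorProduct.ext' fun x y => by simp [sandwich₂]
  rw [h, ← Algebra.algebraMap_eq_smul_one]
  exact HopfAlgebra.mul_antipode_rTensor_comul_apply a

theorem sandwich₂_comul_antipode {A : Type} [Ring A] [HopfAlgebra ℂ A] {z : A}
    (hz : ∀ a, Commute z a) (a : A) :
    sandwich₂ LinearMap.id z (HopfAlgebra.antipode ℂ) (Bialgebra.comulAlgHom ℂ A a) =
      Bialgebra.counitAlgHom ℂ A a • z := by
  have h : sandwich₂ LinearMap.id z (HopfAlgebra.antipode ℂ) =
      LinearMap.mulLeft ℂ z ∘ₗ LinearMap.mul' ℂ A ∘ₗ (HopfAlgebra.antipode ℂ).lTensor A :=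
    TensorProduct.ext' fun x y => by simp [sandwich₂, ← mul_assoc, (hz x).eq]
  calc _ = z * LinearMap.mul' ℂ A ((HopfAlgebra.antipode ℂ).lTensor A (Coalgebra.comul a)) := by
        rw [h]; rfl
    _ = _ := by
        rw [HopfAlgebra.mul_antipode_lTensor_comul_apply, ← Algebra.commutes, ← Algebra.smul_def]
        rfl

variable {S : A →ₗ[ℂ] A} (hS : ∀ a b, S (a * b) = S b * S a)
include hS

theorem sandwich₃_one_tmul_mul (f g : A →ₗ[ℂ] A) (c d x : A) (X : T3 A) :
    sandwich₃ f c g d S (1 ⊗ₜ (1 ⊗ₜ x) * X) = sandwich₃ f c g d S X * S x := by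
  induction X using tensor_induction₃ with
  | add X Y hX hY => simp only [map_add, mul_add, add_mul, hX, hY]
  | tmul u v w => simp [sandwich₃_tmul, mul_assoc, hS]

theorem sandwich₃_mul_tmul_one (f g : A →ₗ[ℂ] A) (c d x : A) (X : T3 A) :
    sandwich₃ S c f d g (X * x ⊗ₜ 1) = S x * sandwich₃ S c f d g X := by
  induction X using tensor_induction₃ with
  | add X Y hX hY => simp only [map_add, add_mul, mul_add, hX, hY]
  | tmul u v w => simp [sandwich₃_tmul, mul_assoc, hS]

theorem sandwich₂_mul_eval (α : A) (Y X : A ⊗[ℂ] A) :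
    sandwich₂ S α LinearMap.id (Y * X) =
      sandwich₂ S (sandwich₂ S α LinearMap.id Y) LinearMap.id X := by
  induction X using TensorProduct.induction_on with
  | zero => simp
  | add X X' h h' => simp only [map_add, mul_add, h, h']
  | tmul x y =>
    rw [sandwich₂_tmul]
    induction Y using TensorProduct.induction_on with
    | zero => simp
    | add Y Y' h h' => simp only [map_add, add_mul, mul_add, h, h']
    | tmul u v => simp [sandwich₂_tmul, hS, mul_assoc]

theorem sandwich₂_mul_coeval (β : A) (X Y : A ⊗[ℂ] A) :
    sandwich₂ LinearMap.id β S (X * Y) =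
      sandwich₂ LinearMap.id (sandwich₂ LinearMap.id β S Y) S X := by
  induction X using TensorProduct.induction_on with
  | zero => simp
  | add X X' h h' => simp only [map_add, add_mul, h, h']
  | tmul x y =>
    rw [sandwich₂_tmul]
    induction Y using TensorProduct.induction_on with
    | zero => simp
    | add Y Y' h h' => simp only [map_add, add_mul, mul_add, h, h']
    | tmul u v => simp [sandwich₂_tmul, hS, mul_assoc]

theorem sandwich₃_leg12_mul (α β : A) (Y : A ⊗[ℂ] A) (X : T3 A) :
    sandwich₃ S α LinearMap.id β S (leg12 Y * X) =
      sandwich₃ S (sandwich₂ S α LinearMap.id Y) LinearMap.id β S X := by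
  induction X using tensor_induction₃ with
  | add X X' h h' => simp only [map_add, mul_add, h, h']
  | tmul x y z =>
    rw [sandwich₃_tmul]
    induction Y using TensorProduct.induction_on with
    | zero => simp
    | add Y Y' h h' => simp only [map_add, add_mul, mul_add, h, h']
    | tmul u v => simp [leg12, sandwich₂_tmul, sandwich₃_tmul, hS, mul_assoc]

theorem sandwich₃_mul_leg23 (α β : A) (X : T3 A) (Y : A ⊗[ℂ] A) :
    sandwich₃ S α LinearMap.id β S (X * leg23 Y) =
      sandwich₃ S α LinearMap.id (sandwich₂ LinearMap.id β S Y) S X := by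
  induction X using tensor_induction₃ with
  | add X X' h h' => simp only [map_add, add_mul, h, h']
  | tmul x y z =>
    rw [sandwich₃_tmul]
    induction Y using TensorProduct.induction_on with
    | zero => simp
    | add Y Y' h h' => simp only [map_add, add_mul, mul_add, h, h']
    | tmul u v => simp [leg23, sandwich₂_tmul, sandwich₃_tmul, hS, mul_assoc]

theorem sandwich₃_mul_leg12 (α β : A) (X : T3 A) (Y : A ⊗[ℂ] A) :
    sandwich₃ LinearMap.id β S α LinearMap.id (X * leg12 Y) =
      sandwich₃ LinearMap.id (sandwich₂ LinearMap.id β S Y) S α LinearMap.id X := by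
  induction X using tensor_induction₃ with
  | add X X' h h' => simp only [map_add, add_mul, h, h']
  | tmul x y z =>
    rw [sandwich₃_tmul]
    induction Y using TensorProduct.induction_on with
    | zero => simp
    | add Y Y' h h' => simp only [map_add, add_mul, mul_add, h, h']
    | tmul u v => simp [leg12, sandwich₂_tmul, sandwich₃_tmul, hS, mul_assoc]

theorem sandwich₃_leg23_mul (α β : A) (Y : A ⊗[ℂ] A) (X : T3 A) :
    sandwich₃ LinearMap.id β S α LinearMap.id (leg23 Y * X) =
      sandwich₃ LinearMap.id β S (sandwich₂ S α LinearMap.id Y) LinearMap.id X := by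
  induction X using tensor_induction₃ with
  | add X X' h h' => simp only [map_add, mul_add, h, h']
  | tmul x y z =>
    rw [sandwich₃_tmul]
    induction Y using TensorProduct.induction_on with
    | zero => simp
    | add Y Y' h h' => simp only [map_add, add_mul, mul_add, h, h']
    | tmul u v => simp [leg23, sandwich₂_tmul, sandwich₃_tmul, hS, mul_assoc]

variable {Δ : A →ₐ[ℂ] A ⊗[ℂ] A} {ε : A →ₐ[ℂ] ℂ} {α β : A}

section Evaluation

variable (hα : ∀ a, sandwich₂ S α LinearMap.id (Δ a) = ε a • α)
include hα

theorem sandwich₃_comulId_mul (β : A) (X : A ⊗[ℂ] A) (Y : T3 A) :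
    sandwich₃ S α LinearMap.id β S (comulId Δ X * Y) =
      sandwich₃ S α LinearMap.id β S Y * S (counitId ε X) := by
  induction X using TensorProduct.induction_on with
  | zero => simp
  | add X X' h h' => simp only [map_add, add_mul, mul_add, h, h']
  | tmul x y =>
    rw [comulId_tmul, mul_assoc, sandwich₃_leg12_mul hS, hα, smul_sandwich₃, counitId_tmul,
      sandwich₃_one_tmul_mul hS, map_smul, mul_smul_comm]

theorem sandwich₃_idComul_mul (β : A) (X : A ⊗[ℂ] A) (Y : T3 A) :
    sandwich₃ LinearMap.id β S α LinearMap.id (idComul Δ X * Y) =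
      idCounit ε X * sandwich₃ LinearMap.id β S α LinearMap.id Y := by
  induction X using TensorProduct.induction_on with
  | zero => simp
  | add X X' h h' => simp only [map_add, add_mul, h, h']
  | tmul x y =>
    have hcomm : x ⊗ₜ 1 * leg23 (Δ y) = leg23 (Δ y) * x ⊗ₜ 1 := by simp [leg23]
    rw [idComul_tmul, hcomm, mul_assoc, sandwich₃_leg23_mul hS, hα, sandwich₃_smul, idCounit_tmul,
      sandwich₃_tmul_one_mul, smul_mul_assoc]

theorem sandwich₂_twistComul_eval (J : (A ⊗[ℂ] A)ˣ) (a : A) :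
    sandwich₂ S (sandwich₂ S α LinearMap.id ↑J⁻¹) LinearMap.id (twistComul Δ J a) =
      ε a • sandwich₂ S α LinearMap.id ↑J⁻¹ := by
  rw [← sandwich₂_mul_eval hS, twistComul_apply, mul_assoc, Units.inv_mul_cancel_left,
    sandwich₂_mul_eval hS, hα, smul_sandwich₂]

end Evaluation

section Coevaluation

variable (hβ : ∀ a, sandwich₂ LinearMap.id β S (Δ a) = ε a • β)
include hβ

theorem sandwich₃_mul_idComul (α : A) (Y : T3 A) (X : A ⊗[ℂ] A) :
    sandwich₃ S α LinearMap.id β S (Y * idComul Δ X) =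
      S (idCounit ε X) * sandwich₃ S α LinearMap.id β S Y := by
  induction X using TensorProduct.induction_on with
  | zero => simp
  | add X X' h h' => simp only [map_add, add_mul, mul_add, h, h']
  | tmul x y =>
    rw [idComul_tmul, ← mul_assoc, sandwich₃_mul_leg23 hS, hβ, sandwich₃_smul, idCounit_tmul,
      sandwich₃_mul_tmul_one hS, map_smul, smul_mul_assoc]

theorem sandwich₃_mul_comulId (α : A) (Y : T3 A) (X : A ⊗[ℂ] A) :
    sandwich₃ LinearMap.id β S α LinearMap.id (Y * comulId Δ X) =
      sandwich₃ LinearMap.id β S α LinearMap.id Y * counitId ε X := by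
  induction X using TensorProduct.induction_on with
  | zero => simp
  | add X X' h h' => simp only [map_add, mul_add, h, h']
  | tmul x y =>
    rw [comulId_tmul, (commute_leg12_one_tmul (Δ x) y).eq, ← mul_assoc, sandwich₃_mul_leg12 hS,
      hβ, smul_sandwich₃, counitId_tmul, sandwich₃_mul_one_tmul, mul_smul_comm]

theorem sandwich₂_twistComul_coeval (J : (A ⊗[ℂ] A)ˣ) (a : A) :
    sandwich₂ LinearMap.id (sandwich₂ LinearMap.id β S J) S (twistComul Δ J a) =
      ε a • sandwich₂ LinearMap.id β S J := by
  rw [← sandwich₂_mul_coeval hS, twistComul_apply, Units.inv_mul_cancel_right,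
    sandwich₂_mul_coeval hS, hβ, smul_sandwich₂]

end Coevaluation

end Sandwich

section Twist

variable {A : Type} [Ring A] [Algebra ℂ A] {J : (A ⊗[ℂ] A)ˣ}

/-- The quasi-bialgebra obtained from `H` by the gauge transformation `J`. -/
def QuasiBialgebra.twist (H : QuasiBialgebra A) (hJ : IsCounital H.counit J) :
    QuasiBialgebra A where
  comul := twistComul H.comul J
  counit := H.counit
  coassociator := twistCoassociator H.comul H.coassociator J
  counit_comul := hJ.counitId_twistComul H.counit_comul
  comul_counit := hJ.idCounit_twistComul H.comul_counit
  quasi_coassoc := twistComul_quasi_coassoc H.quasi_coassoc J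
  coassociator_counital := by
    simp [twistCoassociator, idCounitId_leg12, idCounitId_leg23,
      idCounitId_comulId (ε := H.counit) H.comul_counit,
      idCounitId_idComul (ε := H.counit) H.counit_comul, hJ.idCounit, hJ.inv.counitId,
      H.coassociator_counital, ← Algebra.TensorProduct.one_def]
  cocycle := twistCoassociator_cocycle H.quasi_coassoc H.cocycle J

/-- The quasi-triangular quasi-bialgebra obtained from `H` by the gauge transformation `J`. -/
def QuasiTriangularQuasiBialgebra.twist (H : QuasiTriangularQuasiBialgebra A)
    (hJ : IsCounital H.counit J) : QuasiTriangularQuasiBialgebra A where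
  toQuasiBialgebra := H.toQuasiBialgebra.twist hJ
  rMatrix := twistRMatrix H.rMatrix J
  rMatrix_comul := twistRMatrix_mul_twistComul H.rMatrix_comul J
  comulId_rMatrix := comulId_twistRMatrix H.rMatrix_comul H.comulId_rMatrix J
  idComul_rMatrix := idComul_twistRMatrix H.rMatrix_comul H.idComul_rMatrix J

/-- The quasi-triangular quasi-Hopf algebra obtained from `H` by the gauge transformation `J`.
The antipode is unchanged. -/
def QuasiTriangularQuasiHopfAlgebra.twist (H : QuasiTriangularQuasiHopfAlgebra A)
    (hJ : IsCounital H.counit J) : QuasiTriangularQuasiHopfAlgebra A where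
  toQuasiTriangularQuasiBialgebra := H.toQuasiTriangularQuasiBialgebra.twist hJ
  antipode := H.antipode
  evalElt := sandwich₂ H.antipode H.evalElt LinearMap.id ↑J⁻¹
  coevalElt := sandwich₂ LinearMap.id H.coevalElt H.antipode J
  antipode_one := H.antipode_one
  antipode_mul := H.antipode_mul
  antipode_evalElt := sandwich₂_twistComul_eval H.antipode_mul H.antipode_evalElt J
  coevalElt_antipode := sandwich₂_twistComul_coeval H.antipode_mul H.coevalElt_antipode J
  sandwich_coassociator := by
    change sandwich₃ _ _ _ _ _ (twistCoassociator H.comul H.coassociator J : T3 A) = 1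
    rw [← sandwich₃_leg12_mul H.antipode_mul, ← sandwich₃_mul_leg23 H.antipode_mul]
    simp [twistCoassociator, mul_assoc, map_mul_map_cancel_left, map_inv_mul_map,
      sandwich₃_comulId_mul H.antipode_mul H.antipode_evalElt,
      sandwich₃_mul_idComul H.antipode_mul H.coevalElt_antipode, hJ.counitId, hJ.inv.idCounit,
      H.antipode_one, H.sandwich_coassociator]
  sandwich_coassociator_inv := by
    change sandwich₃ _ _ _ _ _ (↑(twistCoassociator H.comul H.coassociator J)⁻¹ : T3 A) = 1
    rw [← sandwich₃_mul_leg12 H.antipode_mul, ← sandwich₃_leg23_mul H.antipode_mul]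
    simp [twistCoassociator, mul_assoc, map_mul_map_cancel_left, map_inv_mul_map,
      sandwich₃_idComul_mul H.antipode_mul H.antipode_evalElt,
      sandwich₃_mul_comulId H.antipode_mul H.coevalElt_antipode, hJ.idCounit, hJ.inv.counitId,
      H.sandwich_coassociator_inv]

end Twist

section Parity

variable {A : Type} [Ring A] [Algebra ℂ A] {e κ κ' : A} {Δ : A →ₐ[ℂ] A ⊗[ℂ] A}

/-- The coassociator `1 + (κ - 1) ⊗ e ⊗ e`: for an idempotent `e`, it acts by `κ` on the first
factor where the second and third factors are odd, and trivially elsewhere. -/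
def parityCoassociator (e κ : A) : T3 A :=
  1 + (κ - 1) ⊗ₜ (e ⊗ₜ e)

theorem parityCoassociator_one (e : A) : parityCoassociator e 1 = 1 := by
  rw [parityCoassociator, sub_self, TensorProduct.zero_tmul, add_zero]

theorem parityCoassociator_mul (he : e * e = e) (κ κ' : A) :
    parityCoassociator e κ * parityCoassociator e κ' = parityCoassociator e (κ * κ') := by
  have h : κ * κ' - 1 = (κ - 1) * (κ' - 1) + (κ - 1) + (κ' - 1) := by noncomm_ring
  simp only [parityCoassociator, mul_add, add_mul, mul_one, one_mul, h,
    Algebra.TensorProduct.tmul_mul_tmul, he, TensorProduct.add_tmul]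
  abel

theorem parityCoassociator_cocycle (he : e * e = e) (hκ : Commute e κ) (hΔκ : Δ κ = κ ⊗ₜ κ)
    (hΔe : Δ e = e ⊗ₜ (1 - e) + (1 - e) ⊗ₜ e) :
    comulIdId Δ (parityCoassociator e κ) * idIdComul Δ (parityCoassociator e κ) =
      tensorOne (parityCoassociator e κ) * idComulId Δ (parityCoassociator e κ) *
        oneTensor (parityCoassociator e κ) := by
  simp only [parityCoassociator, Algebra.TensorProduct.one_def, TensorProduct.sub_tmul, map_add,
    comulIdId_tmul, tensorOne, leg12, map_one, Algebra.TensorProduct.map_tmul, AlgHom.coe_id,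
    id_eq, Algebra.TensorProduct.includeLeft_apply, Algebra.TensorProduct.tmul_mul_tmul, mul_one,
    map_sub, hΔκ, one_mul, idIdComul, idComul, hΔe, TensorProduct.tmul_sub,
    TensorProduct.tmul_add, mul_add, add_mul, sub_mul, mul_sub, he, add_sub_cancel, idComulId,
    comulId_tmul, oneTensor, Algebra.TensorProduct.includeRight_apply, hκ.eq, sub_self, zero_add]
  abel

theorem idCounitId_parityCoassociator {ε : A →ₐ[ℂ] ℂ} (hε : ε e = 0) (κ : A) :
    idCounitId ε (parityCoassociator e κ) = 1 := by
  simp [parityCoassociator, idCounitId, hε]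

theorem perm132_parityCoassociator (e κ : A) :
    perm132 (parityCoassociator e κ) = parityCoassociator e κ := by
  simp [parityCoassociator, perm132, flip]

theorem perm312_parityCoassociator (e κ : A) :
    perm312 (parityCoassociator e κ) = perm213 (parityCoassociator e κ) := by
  rw [perm312, AlgHom.comp_apply, perm132_parityCoassociator]

theorem commute_parityCoassociator_leg23 (he : ∀ x, Commute e x) (κ : A) (X : A ⊗[ℂ] A) :
    Commute (parityCoassociator e κ) (leg23 X) := by
  refine (Commute.one_left _).add_left ?_
  induction X using TensorProduct.induction_on with
  | zero => simp
  | add X Y hX hY => simpa only [map_add] using hX.add_right hY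
  | tmul x y => simp [commute_iff_eq, leg23, (he x).eq, (he y).eq]

theorem commute_perm213_parityCoassociator_leg13 (he : ∀ x, Commute e x) (κ : A)
    (X : A ⊗[ℂ] A) : Commute (perm213 (parityCoassociator e κ)) (leg13 X) := by
  rw [parityCoassociator, map_add, map_one]
  refine (Commute.one_left _).add_left ?_
  induction X using TensorProduct.induction_on with
  | zero => simp
  | add X Y hX hY => simpa only [map_add] using hX.add_right hY
  | tmul x y => simp [commute_iff_eq, leg13, perm213, (he x).eq, (he y).eq]

theorem leg13_mul_perm132_parityCoassociator_mul_leg23 (he : ∀ x, Commute e x)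
    (hκ : parityCoassociator e κ * parityCoassociator e κ' = 1) (X Y : A ⊗[ℂ] A) :
    leg13 X * perm132 (parityCoassociator e κ) * leg23 Y * parityCoassociator e κ' =
      leg13 X * leg23 Y := by
  rw [perm132_parityCoassociator, mul_assoc (leg13 X),
    (commute_parityCoassociator_leg23 he κ Y).eq, mul_assoc, mul_assoc, hκ, mul_one]

theorem perm312_parityCoassociator_mul_leg13_mul_perm213 (he : ∀ x, Commute e x)
    (hκ : parityCoassociator e κ * parityCoassociator e κ' = 1) (X : A ⊗[ℂ] A) :
    perm312 (parityCoassociator e κ) * leg13 X * perm213 (parityCoassociator e κ') =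
      leg13 X := by
  rw [perm312_parityCoassociator, (commute_perm213_parityCoassociator_leg13 he κ X).eq,
    mul_assoc, ← map_mul, hκ, map_one, mul_one]

end Parity

end QuasiHopf

namespace RestrictedSL2

open Complex (I)
open QuasiHopf

section NormalForm

/-- The rescaling of `F` for which `E * G + G * E = e1`. -/
def G : Q :=
  (-I) • (F * K)

theorem K_mul_K : K * K = e0 - e1 := by
  simp only [e0, e1, pow_two]
  module

theorem Kinv_eq : Kinv = K * (K * K) := by
  have h : K * (K * (K * K)) = 1 := by rw [← K_pow]; noncomm_ring
  calc Kinv = Kinv * (K * (K * (K * K))) := by rw [h, mul_one]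
    _ = K * (K * K) := by rw [← mul_assoc, Kinv_mul_K, one_mul]

theorem K_mul_G : K * G = -(G * K) := by
  simp only [G, mul_smul_comm, smul_mul_assoc, ← mul_assoc, K_mul_F, neg_mul, smul_neg]

theorem G_mul_G : G * G = 0 := by
  simp only [G, mul_smul_comm, smul_mul_assoc, mul_assoc, normalize, mul_neg, smul_zero, neg_zero]

theorem E_mul_G : E * G = e1 - G * E := by
  have hEFK : E * (F * K) = F * (E * K) + (-I / 2) • (K * K - 1) := by
    have h := congrArg (· * K) E_mul_F
    have hI : (2 * I)⁻¹ = -I / 2 := by rw [mul_inv, Complex.inv_I]; ring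
    simp only [sub_mul, smul_mul_assoc, Kinv_mul_K, hI, mul_assoc] at h
    rw [← h]
    abel
  have hI : (-I) * (-I / 2) = -(1 / 2) := by linear_combination Complex.I_mul_I / 2
  simp only [G, mul_smul_comm, smul_mul_assoc, hEFK, mul_assoc, K_mul_E, mul_neg, e1, pow_two,
    smul_add, smul_smul, hI]
  module

theorem F_eq : F = I • (G * Kinv) := by
  simp only [G, smul_mul_assoc, mul_assoc, K_mul_Kinv, mul_one, smul_smul]
  simp

theorem e0_add_e1 : e0 + e1 = 1 := by
  simp only [e0, e1]
  module

theorem e0_eq : e0 = 1 - e1 :=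
  eq_sub_of_add_eq e0_add_e1

theorem e1_mul_e1 : e1 * e1 = e1 := by
  have h : K * (K * (K * K)) = 1 := by rw [← K_pow]; noncomm_ring
  simp only [e1, smul_mul_assoc, mul_smul_comm, mul_sub, sub_mul, pow_two, mul_assoc, h, mul_one,
    one_mul]
  module

theorem e0_mul_e0 : e0 * e0 = e0 := by
  simp [e0_eq, sub_mul, mul_sub, e1_mul_e1]

theorem e0_mul_e1 : e0 * e1 = 0 := by
  simp [e0_eq, sub_mul, e1_mul_e1]

theorem e1_mul_e0 : e1 * e0 = 0 := by
  simp [e0_eq, mul_sub, e1_mul_e1]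

theorem eq_of_mul_e {x y : Q} (h0 : x * e0 = y * e0) (h1 : x * e1 = y * e1) : x = y := by
  rw [← mul_one x, ← mul_one y, ← e0_add_e1, mul_add, mul_add, h0, h1]

theorem mul_algHom_eq_of_generators {B : Type*} [Ring B] [Algebra ℂ B] {f g : Q →ₐ[ℂ] B} {u : B}
    (hE : u * f E = g E * u) (hG : u * f G = g G * u) (hK : u * f K = g K * u) (a : Q) :
    u * f a = g a * u := by
  have hmul (x y : Q) (hx : u * f x = g x * u) (hy : u * f y = g y * u) :
      u * f (x * y) = g (x * y) * u := by
    rw [map_mul, map_mul, ← mul_assoc, hx, mul_assoc, hy, mul_assoc]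
  have hKinv : u * f Kinv = g Kinv * u := by
    rw [Kinv_eq]
    exact hmul _ _ hK (hmul _ _ hK hK)
  have hF : u * f F = g F * u := by
    rw [F_eq, map_smul, map_smul, mul_smul_comm, smul_mul_assoc, hmul _ _ hG hKinv]
  induction a using induction with
  | h1 c => rw [AlgHom.commutes, AlgHom.commutes, Algebra.commutes]
  | hg x =>
    cases x
    exacts [hE, hF, hK, hKinv]
  | hm x y hx hy => exact hmul x y hx hy
  | ha x y hx hy => rw [map_add, map_add, mul_add, add_mul, hx, hy]

theorem commute_e1 (x : Q) : Commute e1 x := by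
  have hKE : K * (K * E) = E * (K * K) := by
    rw [K_mul_E, mul_neg, ← mul_assoc, K_mul_E, neg_mul, neg_neg, mul_assoc]
  have hKG : K * (K * G) = G * (K * K) := by
    rw [K_mul_G, mul_neg, ← mul_assoc, K_mul_G, neg_mul, neg_neg, mul_assoc]
  refine mul_algHom_eq_of_generators (f := AlgHom.id ℂ Q) (g := AlgHom.id ℂ Q) ?_ ?_ ?_ x <;>
    simp [e1, sub_mul, mul_sub, pow_two, mul_assoc, hKE, hKG]

theorem commute_e0 (x : Q) : Commute e0 x := by
  rw [e0_eq]
  exact (Commute.one_left x).sub_left (commute_e1 x)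

theorem commute_e0_add_I_smul_e1 (x : Q) : Commute (e0 + I • e1) x :=
  (commute_e0 x).add_left ((commute_e1 x).smul_left I)

/-- The fermion parity: an involution in the group algebra of `K` that anticommutes with `E`
and `F`. -/
def ω : Q :=
  (e0 + I • e1) * K

theorem ω_mul_E : ω * E = -(E * ω) := by
  rw [ω, mul_assoc, K_mul_E, mul_neg, ← mul_assoc, (commute_e0_add_I_smul_e1 E).eq, mul_assoc]

theorem ω_mul_G : ω * G = -(G * ω) := by
  rw [ω, mul_assoc, K_mul_G, mul_neg, ← mul_assoc, (commute_e0_add_I_smul_e1 G).eq, mul_assoc]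

theorem ω_mul_ω : ω * ω = 1 := by
  calc ω * ω = (e0 + I • e1) * (e0 + I • e1) * (K * K) := by
        have h := (commute_e0_add_I_smul_e1 K).eq
        rw [ω, mul_assoc, ← mul_assoc K, ← h]
        simp only [mul_assoc]
    _ = e0 + e1 := by
        simp [K_mul_K, add_mul, mul_add, mul_sub, e0_mul_e0, e0_mul_e1, e1_mul_e0, e1_mul_e1,
          smul_smul]
    _ = 1 := e0_add_e1

theorem K_eq : K = ω * (e0 - I • e1) := by
  have h : (e0 + I • e1) * (e0 - I • e1) = 1 := by
    rw [← e0_add_e1]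
    simp [add_mul, mul_sub, e0_mul_e0, e0_mul_e1, e1_mul_e0, e1_mul_e1, smul_smul]
  have hK := ((commute_e0 K).sub_left ((commute_e1 K).smul_left I)).eq
  rw [ω, mul_assoc, ← hK, ← mul_assoc, h, one_mul]

theorem Kinv_eq_ω : Kinv = ω * (e0 + I • e1) := by
  have h : (e0 - I • e1) * (e0 - e1) = e0 + I • e1 := by
    simp [sub_mul, mul_sub, e0_mul_e0, e0_mul_e1, e1_mul_e0, e1_mul_e1]
  rw [Kinv_eq, K_mul_K, K_eq, mul_assoc, h]

end NormalForm

section BlockReduction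

-- Conjunctions serve as named sets of rewriting rules for `simp only`. Identities in tensor powers
-- of `Q` are checked on each block cut out by the idempotents `e0` and `e1`: there, `expand_mul`,
-- `expand_tmul` and `mul_rules` reduce both sides to linear combinations of the monomials
-- `G * E * ω * e`, whose coefficients are compared modulo `I * I = -1`.

theorem idempotent_rules :
    e0 * e0 = e0 ∧ e0 * e1 = 0 ∧ e1 * e0 = 0 ∧ e1 * e1 = e1 :=
  ⟨e0_mul_e0, e0_mul_e1, e1_mul_e0, e1_mul_e1⟩

theorem mul_rules (x : Q) :
    ω * (E * x) = -(E * (ω * x)) ∧ ω * (G * x) = -(G * (ω * x)) ∧ ω * (ω * x) = x ∧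
    E * (E * x) = 0 ∧ G * (G * x) = 0 ∧ E * (G * x) = e1 * x - G * (E * x) ∧
    e1 * (E * x) = E * (e1 * x) ∧ e1 * (G * x) = G * (e1 * x) ∧ e1 * (ω * x) = ω * (e1 * x) ∧
    e0 * (E * x) = E * (e0 * x) ∧ e0 * (G * x) = G * (e0 * x) ∧ e0 * (ω * x) = ω * (e0 * x) ∧
    K * x = ω * (e0 * x) - I • (ω * (e1 * x)) ∧ Kinv * x = ω * (e0 * x) + I • (ω * (e1 * x)) ∧
    F * x = I • (G * (Kinv * x)) := by
  simp only [← mul_assoc, ω_mul_E, ω_mul_G, ω_mul_ω, E_sq, G_mul_G, E_mul_G, (commute_e1 E).eq,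
    (commute_e1 G).eq, (commute_e1 ω).eq, (commute_e0 E).eq, (commute_e0 G).eq,
    (commute_e0 ω).eq]
  have hK : K * x = ω * e0 * x - I • (ω * e1 * x) := by
    rw [K_eq, mul_sub, sub_mul, mul_smul_comm, smul_mul_assoc]
  have hKinv : Kinv * x = ω * e0 * x + I • (ω * e1 * x) := by
    rw [Kinv_eq_ω, mul_add, add_mul, mul_smul_comm, smul_mul_assoc]
  simp only [neg_mul, one_mul, zero_mul, sub_mul, hK, hKinv, and_self, F_eq, smul_mul_assoc]

theorem expand_mul {A : Type*} [Ring A] [Algebra ℂ A] :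
    (∀ x y z : A, (x + y) * z = x * z + y * z) ∧ (∀ x y z : A, x * (y + z) = x * y + x * z) ∧
    (∀ x y z : A, (x - y) * z = x * z - y * z) ∧ (∀ x y z : A, x * (y - z) = x * y - x * z) ∧
    (∀ x y : A, -x * y = -(x * y)) ∧ (∀ x y : A, x * -y = -(x * y)) ∧
    (∀ (r : ℂ) (x y : A), r • x * y = r • (x * y)) ∧
    (∀ (r : ℂ) (x y : A), x * r • y = r • (x * y)) ∧
    (∀ x y z : A, x * y * z = x * (y * z)) ∧ (∀ x : A, 1 * x = x) ∧ (∀ x : A, x * 1 = x) ∧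
    (∀ x : A, 0 * x = 0) ∧ (∀ x : A, x * 0 = 0) ∧ (∀ x : A, 0 + x = x) ∧ (∀ x : A, x + 0 = x) ∧
    (∀ x : A, 0 - x = -x) ∧ (∀ x : A, x - 0 = x) ∧ -(0 : A) = 0 ∧ (∀ r : ℂ, r • (0 : A) = 0) :=
  ⟨add_mul, mul_add, sub_mul, mul_sub, neg_mul, mul_neg, smul_mul_assoc, mul_smul_comm, mul_assoc,
    one_mul, mul_one, zero_mul, mul_zero, zero_add, add_zero, zero_sub, sub_zero, neg_zero,
    smul_zero⟩

theorem expand_tmul {A B : Type*} [Ring A] [Algebra ℂ A] [Ring B] [Algebra ℂ B] :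
    (∀ (x y : A) (z : B), (x + y) ⊗ₜ[ℂ] z = x ⊗ₜ z + y ⊗ₜ z) ∧
    (∀ (x : A) (y z : B), x ⊗ₜ[ℂ] (y + z) = x ⊗ₜ y + x ⊗ₜ z) ∧
    (∀ (x y : A) (z : B), (x - y) ⊗ₜ[ℂ] z = x ⊗ₜ z - y ⊗ₜ z) ∧
    (∀ (x : A) (y z : B), x ⊗ₜ[ℂ] (y - z) = x ⊗ₜ y - x ⊗ₜ z) ∧
    (∀ (x : A) (y : B), (-x) ⊗ₜ[ℂ] y = -(x ⊗ₜ y)) ∧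
    (∀ (x : A) (y : B), x ⊗ₜ[ℂ] (-y) = -(x ⊗ₜ y)) ∧
    (∀ (r : ℂ) (x : A) (y : B), (r • x) ⊗ₜ[ℂ] y = r • (x ⊗ₜ y)) ∧
    (∀ (r : ℂ) (x : A) (y : B), x ⊗ₜ[ℂ] (r • y) = r • (x ⊗ₜ y)) ∧
    (∀ x : B, (0 : A) ⊗ₜ[ℂ] x = 0) ∧ (∀ x : A, x ⊗ₜ[ℂ] (0 : B) = 0) ∧
    (∀ (x x' : A) (y y' : B), x ⊗ₜ[ℂ] y * x' ⊗ₜ y' = (x * x') ⊗ₜ (y * y')) :=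
  ⟨TensorProduct.add_tmul, TensorProduct.tmul_add, TensorProduct.sub_tmul, TensorProduct.tmul_sub,
    TensorProduct.neg_tmul, TensorProduct.tmul_neg, fun _ _ _ => rfl,
    fun _ _ _ => TensorProduct.tmul_smul _ _ _, TensorProduct.zero_tmul _,
    TensorProduct.tmul_zero _, Algebra.TensorProduct.tmul_mul_tmul⟩

theorem tensor_ext {B : Type*} [Ring B] [Algebra ℂ B] {X Y : Q ⊗[ℂ] B}
    (h0 : X * e0 ⊗ₜ 1 = Y * e0 ⊗ₜ 1) (h1 : X * e1 ⊗ₜ 1 = Y * e1 ⊗ₜ 1) : X = Y := by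
  have h : (e0 ⊗ₜ 1 + e1 ⊗ₜ 1 : Q ⊗[ℂ] B) = 1 := by
    rw [← TensorProduct.add_tmul, e0_add_e1, Algebra.TensorProduct.one_def]
  rw [← mul_one X, ← mul_one Y, ← h, mul_add, mul_add, h0, h1]

theorem tensor_ext₂ {X Y : Q ⊗[ℂ] Q} (h00 : X * e0 ⊗ₜ e0 = Y * e0 ⊗ₜ e0)
    (h01 : X * e0 ⊗ₜ e1 = Y * e0 ⊗ₜ e1) (h10 : X * e1 ⊗ₜ e0 = Y * e1 ⊗ₜ e0)
    (h11 : X * e1 ⊗ₜ e1 = Y * e1 ⊗ₜ e1) : X = Y := by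
  have h (x : Q) : x ⊗ₜ e0 + x ⊗ₜ e1 = x ⊗ₜ[ℂ] (1 : Q) := by
    rw [← TensorProduct.tmul_add, e0_add_e1]
  apply tensor_ext
  · rw [← h, mul_add, mul_add, h00, h01]
  · rw [← h, mul_add, mul_add, h10, h11]

theorem tensor_ext₃ {X Y : T3 Q}
    (h000 : X * e0 ⊗ₜ (e0 ⊗ₜ e0) = Y * e0 ⊗ₜ (e0 ⊗ₜ e0))
    (h001 : X * e0 ⊗ₜ (e0 ⊗ₜ e1) = Y * e0 ⊗ₜ (e0 ⊗ₜ e1))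
    (h010 : X * e0 ⊗ₜ (e1 ⊗ₜ e0) = Y * e0 ⊗ₜ (e1 ⊗ₜ e0))
    (h011 : X * e0 ⊗ₜ (e1 ⊗ₜ e1) = Y * e0 ⊗ₜ (e1 ⊗ₜ e1))
    (h100 : X * e1 ⊗ₜ (e0 ⊗ₜ e0) = Y * e1 ⊗ₜ (e0 ⊗ₜ e0))
    (h101 : X * e1 ⊗ₜ (e0 ⊗ₜ e1) = Y * e1 ⊗ₜ (e0 ⊗ₜ e1))
    (h110 : X * e1 ⊗ₜ (e1 ⊗ₜ e0) = Y * e1 ⊗ₜ (e1 ⊗ₜ e0))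
    (h111 : X * e1 ⊗ₜ (e1 ⊗ₜ e1) = Y * e1 ⊗ₜ (e1 ⊗ₜ e1)) : X = Y := by
  have h (x y : Q) : x ⊗ₜ[ℂ] (y ⊗ₜ[ℂ] e0) + x ⊗ₜ (y ⊗ₜ e1) = x ⊗ₜ[ℂ] (y ⊗ₜ[ℂ] (1 : Q)) := by
    rw [← TensorProduct.tmul_add, ← TensorProduct.tmul_add, e0_add_e1]
  have h' (x : Q) : x ⊗ₜ[ℂ] (e0 ⊗ₜ[ℂ] (1 : Q)) + x ⊗ₜ (e1 ⊗ₜ 1) = x ⊗ₜ[ℂ] 1 := by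
    rw [← TensorProduct.tmul_add, ← TensorProduct.add_tmul, e0_add_e1,
      Algebra.TensorProduct.one_def]
  apply tensor_ext
  · rw [← h', ← h, ← h]
    simp only [mul_add, h000, h001, h010, h011]
  · rw [← h', ← h, ← h]
    simp only [mul_add, h100, h101, h110, h111]

end BlockReduction

section Gauge

/-- The component on `e0 ⊗ e1` of the gauge transformation. -/
def gauge01 : Q ⊗[ℂ] Q :=
  1 + (1 + I) • E ⊗ₜ (G * ω) - (1 - I) • G ⊗ₜ (E * ω) + (1 - I) • (G * E) ⊗ₜ 1 -
    (2 : ℂ) • (G * E) ⊗ₜ (G * E)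

/-- The component on `e0 ⊗ e1` of the inverse of the gauge transformation. -/
def gauge01Inv : Q ⊗[ℂ] Q :=
  1 - (1 + I) • E ⊗ₜ (G * ω) + (1 - I) • G ⊗ₜ (E * ω) + (1 + I) • (G * E) ⊗ₜ 1 -
    (2 : ℂ) • (G * E) ⊗ₜ (G * E)

/-- The component on `e1 ⊗ e1` of the gauge transformation. -/
def gauge11 : Q ⊗[ℂ] Q :=
  ((1 - (1 + I) • (G * E)) * ω) ⊗ₜ 1

/-- The component on `e1 ⊗ e1` of the inverse of the gauge transformation. -/
def gauge11Inv : Q ⊗[ℂ] Q :=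
  ((1 - (1 - I) • (G * E)) * ω) ⊗ₜ 1

/-- The gauge transformation as an element of `Q ⊗ Q`; its components on `e0 ⊗ e0` and `e1 ⊗ e0`
are trivial. -/
def gaugeElement : Q ⊗[ℂ] Q :=
  1 ⊗ₜ e0 + gauge01 * e0 ⊗ₜ e1 + gauge11 * e1 ⊗ₜ e1

/-- The inverse of `gaugeElement`. -/
def gaugeElementInv : Q ⊗[ℂ] Q :=
  1 ⊗ₜ e0 + gauge01Inv * e0 ⊗ₜ e1 + gauge11Inv * e1 ⊗ₜ e1

theorem gaugeElement_mul_inv : gaugeElement * gaugeElementInv = 1 := by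
  have hI := Complex.I_mul_I
  apply tensor_ext₂ <;>
    simp only [gaugeElement, gaugeElementInv, gauge01, gauge01Inv, gauge11, gauge11Inv, expand_mul,
      expand_tmul, mul_rules, idempotent_rules] <;>
    match_scalars <;> grind

theorem gaugeElementInv_mul : gaugeElementInv * gaugeElement = 1 := by
  have hI := Complex.I_mul_I
  apply tensor_ext₂ <;>
    simp only [gaugeElement, gaugeElementInv, gauge01, gauge01Inv, gauge11, gauge11Inv, expand_mul,
      expand_tmul, mul_rules, idempotent_rules] <;>
    match_scalars <;> grind

/-- The gauge transformation that turns the structure maps of `fermionicQuasiHopf` into those of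
the theorem. -/
def gauge : (Q ⊗[ℂ] Q)ˣ :=
  ⟨gaugeElement, gaugeElementInv, gaugeElement_mul_inv, gaugeElementInv_mul⟩

theorem coe_gauge : (gauge : Q ⊗[ℂ] Q) = gaugeElement :=
  rfl

theorem coe_inv_gauge : (↑gauge⁻¹ : Q ⊗[ℂ] Q) = gaugeElementInv :=
  rfl

end Gauge

local notation "Δ" => Bialgebra.comulAlgHom ℂ Q

local notation "ε" => Bialgebra.counitAlgHom ℂ Q

theorem comul_E : Δ E = 1 ⊗ₜ E + E ⊗ₜ K :=
  comulAlgHom_gen Gen.E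

theorem comul_K : Δ K = K ⊗ₜ K :=
  comulAlgHom_gen Gen.K

theorem comul_G : Δ G = 1 ⊗ₜ G + G ⊗ₜ K := by
  have hF : Δ F = Kinv ⊗ₜ F + F ⊗ₜ 1 := comulAlgHom_gen Gen.F
  simp only [G, map_smul, map_mul, hF, comul_K, expand_mul, expand_tmul, Kinv_mul_K, smul_add]

theorem map_e1 {B : Type*} [Ring B] [Algebra ℂ B] (f : Q →ₐ[ℂ] B) :
    f e1 = (1 / 2 : ℂ) • (1 - f K ^ 2) := by
  rw [e1, map_smul, map_sub, map_one, map_pow]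

theorem comul_e1 : Δ e1 = e0 ⊗ₜ e1 + e1 ⊗ₜ e0 := by
  rw [map_e1, comul_K, Algebra.TensorProduct.tmul_pow, pow_two, K_mul_K,
    Algebra.TensorProduct.one_def, ← e0_add_e1]
  simp only [expand_tmul]
  module

theorem counit_E : ε E = 0 :=
  counitAlgHom_gen Gen.E

theorem counit_K : ε K = 1 :=
  counitAlgHom_gen Gen.K

theorem counit_G : ε G = 0 := by
  have hF : ε F = 0 := counitAlgHom_gen Gen.F
  rw [G, map_smul, map_mul, hF, zero_mul, smul_zero]

theorem counit_e1 : ε e1 = 0 := by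
  rw [map_e1, counit_K, one_pow, sub_self, smul_zero]

theorem counit_e0 : ε e0 = 1 := by
  rw [e0_eq, map_sub, map_one, counit_e1, sub_zero]

theorem gauge_isCounital : IsCounital ε gauge where
  counitId := by
    simp only [coe_gauge, gaugeElement, gauge01, gauge11, map_add, map_sub, map_mul, map_smul,
      map_one, counitId_tmul, counit_E, counit_G, counit_e0, counit_e1, zero_smul, smul_zero,
      one_smul, mul_zero, add_zero, sub_zero, one_mul, e0_add_e1]
  idCounit := by
    simp only [coe_gauge, gaugeElement, map_add, map_mul, idCounit_tmul, counit_e0, counit_e1,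
      zero_smul, one_smul, mul_zero, add_zero]

/-- The comultiplication of `Q` conjugated by the inverse of the gauge transformation. -/
def fermionicComul : Q →ₐ[ℂ] Q ⊗[ℂ] Q :=
  twistComul Δ gauge⁻¹

local notation "Δ₀" => fermionicComul

theorem fermionicComul_E : Δ₀ E = 1 ⊗ₜ E + E ⊗ₜ ω := by
  have hI := Complex.I_mul_I
  apply twistComul_inv_apply_eq
  rw [comul_E, coe_gauge]
  apply tensor_ext₂ <;>
    simp only [gaugeElement, gauge01, gauge11, expand_mul, expand_tmul, mul_rules,
      idempotent_rules] <;>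
    match_scalars <;> grind

theorem fermionicComul_G : Δ₀ G = 1 ⊗ₜ G + G ⊗ₜ ((e0 - e1) * ω) := by
  have hI := Complex.I_mul_I
  apply twistComul_inv_apply_eq
  rw [comul_G, coe_gauge]
  apply tensor_ext₂ <;>
    simp only [gaugeElement, gauge01, gauge11, expand_mul, expand_tmul, mul_rules,
      idempotent_rules] <;>
    match_scalars <;> grind

theorem fermionicComul_K : Δ₀ K = K ⊗ₜ K := by
  apply twistComul_inv_apply_eq
  rw [comul_K, coe_gauge]
  apply tensor_ext₂ <;>
    simp only [gaugeElement, gauge01, gauge11, expand_mul, expand_tmul, mul_rules,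
      idempotent_rules] <;>
    module

theorem fermionicComul_e1 : Δ₀ e1 = e0 ⊗ₜ e1 + e1 ⊗ₜ e0 := by
  rw [map_e1, fermionicComul_K, ← comul_K, ← map_e1, comul_e1]

theorem fermionicComul_e0 : Δ₀ e0 = e0 ⊗ₜ e0 + e1 ⊗ₜ e1 := by
  rw [e0_eq, map_sub, map_one, fermionicComul_e1, Algebra.TensorProduct.one_def, ← e0_add_e1]
  simp only [expand_tmul, add_sub_cancel_right]
  abel

theorem fermionicComul_ω : Δ₀ ω = ω ⊗ₜ ω * (1 - (2 : ℂ) • e1 ⊗ₜ e1) := by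
  have hI := Complex.I_mul_I
  simp only [ω, map_mul, map_add, map_smul, fermionicComul_e0, fermionicComul_e1,
    fermionicComul_K]
  apply tensor_ext₂ <;>
    simp only [expand_mul, expand_tmul, mul_rules, idempotent_rules]
  match_scalars
  grind

section Coassociator

/-- The element by which the coassociator of `fermionicQuasiHopf` acts where its last two factors
are odd; it satisfies `κ ^ 2 = K ^ 2` and is grouplike for `fermionicComul`. -/
def κ (β : ℂ) : Q :=
  (e0 - β ^ 2 • e1) * ω

/-- The inverse of `κ`. -/
def κInv (β : ℂ) : Q :=
  (e0 + β ^ 2 • e1) * ω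

variable {β : ℂ} (hβ : β ^ 4 = -1)

include hβ in
theorem κ_mul_κInv : κ β * κInv β = 1 := by
  apply eq_of_mul_e <;>
    simp only [κ, κInv, expand_mul, mul_rules, idempotent_rules]
  match_scalars
  grind

include hβ in
theorem κInv_mul_κ : κInv β * κ β = 1 := by
  apply eq_of_mul_e <;>
    simp only [κ, κInv, expand_mul, mul_rules, idempotent_rules]
  match_scalars
  grind

include hβ in
theorem parityCoassociator_κ_mul_κInv :
    parityCoassociator e1 (κ β) * parityCoassociator e1 (κInv β) = 1 := by
  rw [parityCoassociator_mul e1_mul_e1, κ_mul_κInv hβ, parityCoassociator_one]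

include hβ in
theorem parityCoassociator_κInv_mul_κ :
    parityCoassociator e1 (κInv β) * parityCoassociator e1 (κ β) = 1 := by
  rw [parityCoassociator_mul e1_mul_e1, κInv_mul_κ hβ, parityCoassociator_one]

include hβ in
theorem fermionicComul_κ : Δ₀ (κ β) = κ β ⊗ₜ κ β := by
  simp only [κ, map_mul, map_sub, map_smul, fermionicComul_e0, fermionicComul_e1,
    fermionicComul_ω]
  apply tensor_ext₂ <;>
    simp only [expand_mul, expand_tmul, mul_rules, idempotent_rules]
  match_scalars
  grind

theorem parityCoassociator_mul_idComul_E :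
    parityCoassociator e1 (κ β) * idComul Δ₀ (Δ₀ E) =
      comulId Δ₀ (Δ₀ E) * parityCoassociator e1 (κ β) := by
  simp only [parityCoassociator, κ, fermionicComul_E, fermionicComul_ω, idComul_tmul,
    comulId_tmul, legs_tmul, map_one, map_add, map_mul, map_sub, map_smul]
  apply tensor_ext₃ <;>
    simp only [expand_mul, expand_tmul, mul_rules, idempotent_rules] <;>
    match_scalars <;> grind

theorem parityCoassociator_mul_idComul_G :
    parityCoassociator e1 (κ β) * idComul Δ₀ (Δ₀ G) =
      comulId Δ₀ (Δ₀ G) * parityCoassociator e1 (κ β) := by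
  simp only [parityCoassociator, κ, fermionicComul_e0, fermionicComul_e1, fermionicComul_G,
    fermionicComul_ω, idComul_tmul, comulId_tmul, legs_tmul, map_one, map_add, map_mul, map_sub,
    map_smul]
  apply tensor_ext₃ <;>
    simp only [expand_mul, expand_tmul, mul_rules, idempotent_rules] <;>
    match_scalars <;> grind

theorem parityCoassociator_mul_idComul_K :
    parityCoassociator e1 (κ β) * idComul Δ₀ (Δ₀ K) =
      comulId Δ₀ (Δ₀ K) * parityCoassociator e1 (κ β) := by
  simp only [parityCoassociator, κ, fermionicComul_K, idComul_tmul, comulId_tmul, legs_tmul]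
  apply tensor_ext₃ <;>
    simp only [expand_mul, expand_tmul, mul_rules, idempotent_rules]

theorem parityCoassociator_mul_idComul (a : Q) :
    parityCoassociator e1 (κ β) * idComul Δ₀ (Δ₀ a) =
      comulId Δ₀ (Δ₀ a) * parityCoassociator e1 (κ β) :=
  mul_algHom_eq_of_generators (f := (idComul Δ₀).comp Δ₀) (g := (comulId Δ₀).comp Δ₀)
    parityCoassociator_mul_idComul_E parityCoassociator_mul_idComul_G
    parityCoassociator_mul_idComul_K a

end Coassociator

section RMatrix

/-- The antipode of `ω`; it is another involution that anticommutes with `E` and `F`. -/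
def ω' : Q :=
  (e0 - e1) * ω

/-- The element `-i F (e0 + i e1)`, which is paired with `E` in the R-matrix of
`fermionicQuasiHopf`. -/
def g : Q :=
  G * ω'

/-- The Cartan part of the R-matrix of `fermionicQuasiHopf`. -/
def cartan (β : ℂ) : Q ⊗[ℂ] Q :=
  (1 / 2 : ℂ) • (1 + 1 ⊗ₜ ω' + ω ⊗ₜ 1 - ω ⊗ₜ ω') * (1 + (β - 1) • e1 ⊗ₜ e1)

/-- The unipotent element `1 - r E ⊗ g`, which for `r = 2` is the second factor of the R-matrix
of `fermionicQuasiHopf`. -/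
def nilpotentPart (r : ℂ) : Q ⊗[ℂ] Q :=
  1 - r • E ⊗ₜ g

theorem g_mul_g : g * g = 0 := by
  apply eq_of_mul_e <;>
    simp only [g, ω', expand_mul, mul_rules]

theorem cartan_mul_cartan {r s : ℂ} (h : r * s = 1) : cartan r * cartan s = 1 := by
  apply tensor_ext₂ <;>
    simp only [cartan, ω', expand_mul, expand_tmul, mul_rules, idempotent_rules] <;>
    match_scalars <;> grind

theorem nilpotentPart_mul (r s : ℂ) :
    nilpotentPart r * nilpotentPart s = nilpotentPart (r + s) := by
  simp only [nilpotentPart, expand_mul, expand_tmul, E_sq, g_mul_g]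
  module

theorem nilpotentPart_zero : nilpotentPart 0 = 1 := by
  simp only [nilpotentPart, zero_smul, sub_zero]

/-- The R-matrix of `fermionicQuasiHopf`. -/
def fermionicRMatrix (β : ℂ) : Q ⊗[ℂ] Q :=
  cartan β * nilpotentPart 2

/-- The inverse of `fermionicRMatrix`. -/
def fermionicRMatrixInv (β : ℂ) : Q ⊗[ℂ] Q :=
  nilpotentPart (-2) * cartan β⁻¹

theorem fermionicRMatrix_mul_inv {β : ℂ} (hβ : β ≠ 0) :
    fermionicRMatrix β * fermionicRMatrixInv β = 1 := by
  rw [fermionicRMatrix, fermionicRMatrixInv, mul_assoc, ← mul_assoc (nilpotentPart 2),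
    nilpotentPart_mul, add_neg_cancel, nilpotentPart_zero, one_mul,
    cartan_mul_cartan (mul_inv_cancel₀ hβ)]

theorem fermionicRMatrixInv_mul {β : ℂ} (hβ : β ≠ 0) :
    fermionicRMatrixInv β * fermionicRMatrix β = 1 := by
  rw [fermionicRMatrix, fermionicRMatrixInv, mul_assoc, ← mul_assoc (cartan _),
    cartan_mul_cartan (inv_mul_cancel₀ hβ), one_mul, nilpotentPart_mul, neg_add_cancel,
    nilpotentPart_zero]

variable {β : ℂ}

theorem fermionicRMatrix_mul_fermionicComul_E :
    fermionicRMatrix β * Δ₀ E = QuasiHopf.flip (Δ₀ E) * fermionicRMatrix β := by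
  simp only [fermionicRMatrix, nilpotentPart, cartan, g, ω', fermionicComul_E, map_add,
    flip_tmul]
  apply tensor_ext₂ <;>
    simp only [expand_mul, expand_tmul, mul_rules, idempotent_rules] <;>
    match_scalars <;> grind

theorem fermionicRMatrix_mul_fermionicComul_G :
    fermionicRMatrix β * Δ₀ G = QuasiHopf.flip (Δ₀ G) * fermionicRMatrix β := by
  simp only [fermionicRMatrix, nilpotentPart, cartan, g, ω', fermionicComul_G, map_add,
    flip_tmul]
  apply tensor_ext₂ <;>
    simp only [expand_mul, expand_tmul, mul_rules, idempotent_rules] <;>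
    match_scalars <;> grind

theorem fermionicRMatrix_mul_fermionicComul_K :
    fermionicRMatrix β * Δ₀ K = QuasiHopf.flip (Δ₀ K) * fermionicRMatrix β := by
  simp only [fermionicRMatrix, nilpotentPart, cartan, g, ω', fermionicComul_K, flip_tmul]
  apply tensor_ext₂ <;>
    simp only [expand_mul, expand_tmul, mul_rules, idempotent_rules] <;>
    match_scalars <;> grind

theorem fermionicRMatrix_mul_fermionicComul (a : Q) :
    fermionicRMatrix β * Δ₀ a = QuasiHopf.flip (Δ₀ a) * fermionicRMatrix β :=
  mul_algHom_eq_of_generators (f := Δ₀) (g := QuasiHopf.flip.comp Δ₀)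
    fermionicRMatrix_mul_fermionicComul_E fermionicRMatrix_mul_fermionicComul_G
    fermionicRMatrix_mul_fermionicComul_K a

theorem one_tmul_g_mul_cartan : 1 ⊗ₜ g * cartan β = cartan β * ω ⊗ₜ g := by
  apply tensor_ext₂ <;>
    simp only [cartan, g, ω', expand_mul, expand_tmul, mul_rules, idempotent_rules] <;>
    match_scalars <;> grind

theorem E_tmul_one_mul_cartan : E ⊗ₜ 1 * cartan β = cartan β * E ⊗ₜ ω' := by
  apply tensor_ext₂ <;>
    simp only [cartan, ω', expand_mul, expand_tmul, mul_rules, idempotent_rules] <;>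
    match_scalars <;> grind

theorem fermionicComul_g : Δ₀ g = (ω' ⊗ₜ g + g ⊗ₜ 1) * (1 - (2 : ℂ) • e1 ⊗ₜ e1) := by
  simp only [g, ω', map_mul, map_sub, fermionicComul_G, fermionicComul_e0,
    fermionicComul_e1, fermionicComul_ω]
  apply tensor_ext₂ <;>
    simp only [expand_mul, expand_tmul, mul_rules, idempotent_rules] <;>
    match_scalars <;> grind

theorem comulId_cartan (hβ : β ^ 4 = -1) :
    comulId Δ₀ (cartan β) =
      perm231 (parityCoassociator e1 (κInv β)) * leg13 (cartan β) * leg23 (cartan β) := by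
  simp only [parityCoassociator, κInv, cartan, ω', fermionicComul_ω, fermionicComul_e1,
    comulId_tmul, legs_tmul, perm231_tmul, map_one, map_add, map_mul, map_sub,
    map_smul]
  apply tensor_ext₃ <;> simp only [mul_assoc] <;>
    simp only [expand_mul, expand_tmul, mul_rules, idempotent_rules] <;>
    match_scalars <;> grind

theorem idComul_cartan (hβ : β ^ 4 = -1) :
    idComul Δ₀ (cartan β) =
      leg13 (cartan β) * leg12 (cartan β) * parityCoassociator e1 (κ β) := by
  simp only [parityCoassociator, κ, cartan, ω', fermionicComul_ω, fermionicComul_e0,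
    fermionicComul_e1, idComul_tmul, legs_tmul, map_one, map_add, map_mul, map_sub,
    map_smul]
  apply tensor_ext₃ <;> simp only [mul_assoc] <;>
    simp only [expand_mul, expand_tmul, mul_rules, idempotent_rules] <;>
    match_scalars <;> grind

end RMatrix

section Hexagons

variable {β : ℂ}

theorem comulId_nilpotentPart :
    comulId Δ₀ (nilpotentPart 2) = (1 - (2 : ℂ) • E ⊗ₜ (ω ⊗ₜ g)) * leg23 (nilpotentPart 2) := by
  simp only [nilpotentPart, map_sub, map_add, map_one, map_smul, comulId_tmul, fermionicComul_E,
    legs_tmul, expand_mul, expand_tmul, g_mul_g]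
  module

theorem leg13_nilpotentPart_mul_leg23_cartan :
    leg13 (nilpotentPart 2) * leg23 (cartan β) =
      leg23 (cartan β) * (1 - (2 : ℂ) • E ⊗ₜ (ω ⊗ₜ g)) := by
  have h : E ⊗ₜ (1 ⊗ₜ g) * leg23 (cartan β) = leg23 (cartan β) * E ⊗ₜ (ω ⊗ₜ g) := by
    simp only [leg23, Algebra.TensorProduct.includeRight_apply,
      Algebra.TensorProduct.tmul_mul_tmul, one_tmul_g_mul_cartan, mul_one, one_mul]
  simp only [nilpotentPart, map_sub, map_one, map_smul, legs_tmul, sub_mul, mul_sub, one_mul,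
    mul_one, smul_mul_assoc, mul_smul_comm, h]

theorem parityCoassociator_mul_idComul_nilpotentPart :
    parityCoassociator e1 (κ β) * idComul Δ₀ (nilpotentPart 2) =
      (1 - (2 : ℂ) • E ⊗ₜ (ω' ⊗ₜ g)) * leg12 (nilpotentPart 2) *
        parityCoassociator e1 (κ β) := by
  simp only [nilpotentPart, parityCoassociator, κ, map_sub, map_add, map_one, map_smul, map_mul,
    idComul_tmul, fermionicComul_g, legs_tmul]
  apply tensor_ext₃ <;> simp only [mul_assoc] <;>
    simp only [g, ω', expand_mul, expand_tmul, mul_rules, idempotent_rules] <;>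
    match_scalars <;> grind

theorem leg13_nilpotentPart_mul_leg12_cartan :
    leg13 (nilpotentPart 2) * leg12 (cartan β) =
      leg12 (cartan β) * (1 - (2 : ℂ) • E ⊗ₜ (ω' ⊗ₜ g)) := by
  have h : E ⊗ₜ (1 ⊗ₜ g) * leg12 (cartan β) = leg12 (cartan β) * E ⊗ₜ (ω' ⊗ₜ g) := by
    have hg (x y : Q) : (x ⊗ₜ (y ⊗ₜ g) : T3 Q) = leg12 (x ⊗ₜ y) * 1 ⊗ₜ (1 ⊗ₜ g) := by
      simp only [legs_tmul, Algebra.TensorProduct.tmul_mul_tmul, mul_one, one_mul]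
    rw [hg E 1, hg E ω', mul_assoc, ← (commute_leg12_one_tmul _ _).eq, ← mul_assoc, ← map_mul,
      E_tmul_one_mul_cartan, map_mul, mul_assoc]
  simp only [nilpotentPart, map_sub, map_one, map_smul, legs_tmul, sub_mul, mul_sub, one_mul,
    mul_one, smul_mul_assoc, mul_smul_comm, h]

theorem comulId_fermionicRMatrix (hβ : β ^ 4 = -1) :
    comulId Δ₀ (fermionicRMatrix β) =
      perm231 (parityCoassociator e1 (κInv β)) * leg13 (fermionicRMatrix β) *
        perm132 (parityCoassociator e1 (κ β)) * leg23 (fermionicRMatrix β) *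
        parityCoassociator e1 (κInv β) := by
  calc
    _ = perm231 (parityCoassociator e1 (κInv β)) * (leg13 (cartan β) *
        (leg23 (cartan β) * (1 - (2 : ℂ) • E ⊗ₜ (ω ⊗ₜ g)) * leg23 (nilpotentPart 2))) := by
        simp only [fermionicRMatrix, map_mul, comulId_cartan hβ, comulId_nilpotentPart, mul_assoc]
    _ = perm231 (parityCoassociator e1 (κInv β)) *
        (leg13 (fermionicRMatrix β) * leg23 (fermionicRMatrix β)) := by
        simp only [← leg13_nilpotentPart_mul_leg23_cartan, fermionicRMatrix, map_mul, mul_assoc]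
    _ = _ := by
        rw [← leg13_mul_perm132_parityCoassociator_mul_leg23 commute_e1
          (parityCoassociator_κ_mul_κInv hβ)]
        simp only [mul_assoc]

theorem idComul_fermionicRMatrix (hβ : β ^ 4 = -1) :
    idComul Δ₀ (fermionicRMatrix β) =
      perm312 (parityCoassociator e1 (κ β)) * leg13 (fermionicRMatrix β) *
        perm213 (parityCoassociator e1 (κInv β)) * leg12 (fermionicRMatrix β) *
        parityCoassociator e1 (κ β) := by
  calc
    _ = leg13 (cartan β) * (leg12 (cartan β) * (1 - (2 : ℂ) • E ⊗ₜ (ω' ⊗ₜ g)) *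
        leg12 (nilpotentPart 2) * parityCoassociator e1 (κ β)) := by
        simp only [fermionicRMatrix, map_mul, idComul_cartan hβ, mul_assoc,
          parityCoassociator_mul_idComul_nilpotentPart]
    _ = leg13 (fermionicRMatrix β) * leg12 (fermionicRMatrix β) *
        parityCoassociator e1 (κ β) := by
        simp only [← leg13_nilpotentPart_mul_leg12_cartan, fermionicRMatrix, map_mul, mul_assoc]
    _ = _ := by
        rw [perm312_parityCoassociator_mul_leg13_mul_perm213 commute_e1
          (parityCoassociator_κ_mul_κInv hβ)]

end Hexagons

section Antipode

local notation "S" => HopfAlgebra.antipode ℂ (A := Q)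

theorem antipode_one : S 1 = 1 :=
  antipodeMap_one

theorem antipode_mul (x y : Q) : S (x * y) = S y * S x :=
  antipodeMap_mul x y

theorem antipode_E : S E = -(E * Kinv) :=
  antipode_gen Gen.E

theorem antipode_K : S K = Kinv :=
  antipode_gen Gen.K

theorem antipode_G : S G = -(G * Kinv) := by
  have hF : S F = -(K * F) := antipode_gen Gen.F
  rw [G, map_smul, antipode_mul, antipode_K, hF, mul_neg, ← mul_assoc, Kinv_mul_K, one_mul,
    smul_mul_assoc, mul_assoc, K_mul_Kinv, mul_one, smul_neg]

theorem Kinv_mul_Kinv : Kinv * Kinv = K * K := by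
  rw [Kinv_eq]
  apply eq_of_mul_e <;>
    simp only [expand_mul, mul_rules, idempotent_rules]
  match_scalars
  simp

theorem antipode_e1 : S e1 = e1 := by
  rw [e1, map_smul, map_sub, pow_two, antipode_one, antipode_mul, antipode_K, Kinv_mul_Kinv]

theorem antipode_e0 : S e0 = e0 := by
  rw [e0_eq, map_sub, antipode_one, antipode_e1]

theorem antipode_ω : S ω = ω' := by
  rw [ω, antipode_mul, map_add, map_smul, antipode_K, antipode_e0, antipode_e1, Kinv_eq_ω]
  apply eq_of_mul_e <;>
    simp only [ω', expand_mul, mul_rules, idempotent_rules]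
  match_scalars
  simp

/-- The evaluation element of `fermionicQuasiHopf`. -/
def fermionicEval : Q :=
  e0 + (I • 1 - (1 + I) • (G * E)) * ω * e1

/-- The coevaluation element of `fermionicQuasiHopf`. -/
def fermionicCoeval (β : ℂ) : Q :=
  e0 + (I * β ^ 2) • (1 - (1 + I) • (G * E)) * e1

/-- The coevaluation element of the theorem. -/
def coevaluation (β : ℂ) : Q :=
  e0 - (2 * I * β ^ 2) • (Casimir * e1)

theorem sandwich₂_gauge : sandwich₂ S 1 LinearMap.id (gauge : Q ⊗[ℂ] Q) = fermionicEval := by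
  have hI := Complex.I_mul_I
  simp only [coe_gauge, gaugeElement, gauge01, gauge11, fermionicEval, ω', expand_mul,
    expand_tmul, map_add, map_sub, map_smul, sandwich₂_tmul, antipode_mul, antipode_E, antipode_G,
    antipode_one, antipode_ω, antipode_e0, antipode_e1, LinearMap.id_apply]
  apply eq_of_mul_e <;>
    simp only [expand_mul, mul_rules, idempotent_rules]
  match_scalars <;> grind

variable {β : ℂ}

theorem sandwich₂_gauge_inv :
    sandwich₂ LinearMap.id (coevaluation β) S (↑gauge⁻¹ : Q ⊗[ℂ] Q) = fermionicCoeval β := by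
  have hI := Complex.I_mul_I
  simp only [coe_inv_gauge, gaugeElementInv, gauge01Inv, gauge11Inv, fermionicCoeval,
    coevaluation, Casimir, ω', expand_mul, expand_tmul, map_add, map_sub, map_smul, sandwich₂_tmul,
    antipode_mul, antipode_E, antipode_G, antipode_ω, antipode_e0, antipode_e1,
    LinearMap.id_apply]
  apply eq_of_mul_e <;>
    simp only [expand_mul, mul_rules, idempotent_rules]
  match_scalars <;> grind

theorem sandwich₂_gauge_inv_fermionicEval :
    sandwich₂ S fermionicEval LinearMap.id (↑gauge⁻¹ : Q ⊗[ℂ] Q) = 1 := by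
  rw [← sandwich₂_gauge, ← sandwich₂_mul_eval antipode_mul, Units.mul_inv,
    Algebra.TensorProduct.one_def, sandwich₂_tmul, antipode_one, LinearMap.id_apply, mul_one,
    mul_one]

theorem sandwich₂_gauge_fermionicCoeval :
    sandwich₂ LinearMap.id (fermionicCoeval β) S (gauge : Q ⊗[ℂ] Q) = coevaluation β := by
  rw [← sandwich₂_gauge_inv, ← sandwich₂_mul_coeval antipode_mul, Units.mul_inv,
    Algebra.TensorProduct.one_def, sandwich₂_tmul, antipode_one, LinearMap.id_apply, one_mul,
    mul_one]

theorem commute_coevaluation (a : Q) : Commute (coevaluation β) a := by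
  have hI := Complex.I_mul_I
  refine mul_algHom_eq_of_generators (f := AlgHom.id ℂ Q) (g := AlgHom.id ℂ Q) ?_ ?_ ?_ a <;>
    simp only [coevaluation, Casimir, AlgHom.id_apply] <;>
    apply eq_of_mul_e <;>
    simp only [expand_mul, mul_rules, idempotent_rules] <;>
    match_scalars <;> grind

theorem sandwich₂_fermionicComul_eval (a : Q) :
    sandwich₂ S fermionicEval LinearMap.id (Δ₀ a) = ε a • fermionicEval := by
  rw [← sandwich₂_gauge]
  exact sandwich₂_twistComul_eval antipode_mul sandwich₂_antipode_comul gauge⁻¹ a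

theorem sandwich₂_fermionicComul_coeval (a : Q) :
    sandwich₂ LinearMap.id (fermionicCoeval β) S (Δ₀ a) = ε a • fermionicCoeval β := by
  rw [← sandwich₂_gauge_inv]
  exact sandwich₂_twistComul_coeval antipode_mul (sandwich₂_comul_antipode commute_coevaluation)
    gauge⁻¹ a

theorem sandwich₃_parityCoassociator_κ (hβ : β ^ 4 = -1) :
    sandwich₃ S fermionicEval LinearMap.id (fermionicCoeval β) S (parityCoassociator e1 (κ β)) =
      1 := by
  have hI := Complex.I_mul_I
  simp only [parityCoassociator, Algebra.TensorProduct.one_def, map_add, map_sub, map_smul,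
    sandwich₃_tmul, κ, ω', antipode_one, antipode_mul, antipode_e0, antipode_e1, antipode_ω,
    fermionicEval, fermionicCoeval, LinearMap.id_apply]
  apply eq_of_mul_e <;>
    simp only [expand_mul, mul_rules, idempotent_rules]
  match_scalars <;> grind

theorem sandwich₃_parityCoassociator_κInv (hβ : β ^ 4 = -1) :
    sandwich₃ LinearMap.id (fermionicCoeval β) S fermionicEval LinearMap.id
      (parityCoassociator e1 (κInv β)) = 1 := by
  have hI := Complex.I_mul_I
  simp only [parityCoassociator, Algebra.TensorProduct.one_def, map_add, map_sub, sandwich₃_tmul,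
    κInv, antipode_one, antipode_e1, fermionicEval, fermionicCoeval, LinearMap.id_apply]
  apply eq_of_mul_e <;>
    simp only [expand_mul, mul_rules, idempotent_rules]
  match_scalars <;> grind

/-- The quasi-triangular quasi-Hopf algebra structure on `Q` whose coassociator and Cartan part of
the R-matrix lie in the group algebra of `K`. -/
def fermionicQuasiHopf (hβ : β ^ 4 = -1) : QuasiTriangularQuasiHopfAlgebra Q where
  comul := Δ₀
  counit := ε
  coassociator := ⟨parityCoassociator e1 (κ β), parityCoassociator e1 (κInv β),
    parityCoassociator_κ_mul_κInv hβ, parityCoassociator_κInv_mul_κ hβ⟩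
  counit_comul := gauge_isCounital.inv.counitId_twistComul counitId_comulAlgHom
  comul_counit := gauge_isCounital.inv.idCounit_twistComul idCounit_comulAlgHom
  quasi_coassoc a := (Units.eq_mul_inv_iff_mul_eq _).2 (parityCoassociator_mul_idComul a).symm
  coassociator_counital := idCounitId_parityCoassociator counit_e1 _
  cocycle := parityCoassociator_cocycle e1_mul_e1 (commute_e1 _) (fermionicComul_κ hβ) <| by
    rw [fermionicComul_e1, ← e0_eq, add_comm]
  rMatrix := ⟨fermionicRMatrix β, fermionicRMatrixInv β,
    fermionicRMatrix_mul_inv (by rintro rfl; norm_num at hβ),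
    fermionicRMatrixInv_mul (by rintro rfl; norm_num at hβ)⟩
  rMatrix_comul := fermionicRMatrix_mul_fermionicComul
  comulId_rMatrix := comulId_fermionicRMatrix hβ
  idComul_rMatrix := idComul_fermionicRMatrix hβ
  antipode := S
  evalElt := fermionicEval
  coevalElt := fermionicCoeval β
  antipode_one := antipode_one
  antipode_mul := antipode_mul
  antipode_evalElt := sandwich₂_fermionicComul_eval
  coevalElt_antipode := sandwich₂_fermionicComul_coeval
  sandwich_coassociator := sandwich₃_parityCoassociator_κ hβ
  sandwich_coassociator_inv := sandwich₃_parityCoassociator_κInv hβ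

end Antipode

section Comparison

theorem R00_eq_RStandard : R00 = RStandard := by
  simp only [R00, RStandard, Finset.sum_range_succ, Finset.sum_range_zero, zero_add, mul_zero,
    mul_one, pow_zero, pow_one, one_smul, smul_mul_assoc, neg_one_smul, add_mul, sub_mul]
  congr 1
  abel

theorem RMat_mul_e0 (β : ℂ) : RMat β * e0 ⊗ₜ e0 = RStandard * e0 ⊗ₜ e0 := by
  simp only [RMat, add_mul, mul_assoc, Algebra.TensorProduct.tmul_mul_tmul, e0_mul_e0, e1_mul_e0,
    TensorProduct.tmul_zero, TensorProduct.zero_tmul, mul_zero, add_zero, R00_eq_RStandard]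

variable {β : ℂ}

theorem RMat_mul_gauge :
    RMat β * gaugeElement = QuasiHopf.flip gaugeElement * fermionicRMatrix β := by
  have hI := Complex.I_mul_I
  simp only [gaugeElement, gauge01, gauge11, RMat, R00, R01, R10, R11, fermionicRMatrix,
    cartan, nilpotentPart, g, ω', Algebra.TensorProduct.one_def, map_add, map_mul, map_sub,
    map_smul, flip_tmul]
  apply tensor_ext₂ <;> simp only [mul_assoc] <;>
    simp only [expand_mul, expand_tmul, mul_rules, idempotent_rules] <;>
    match_scalars <;> grind

theorem Phi010_mul_gauge :
    Phi010 * (idComul Δ₀ gauge01 * e0 ⊗ₜ (e1 ⊗ₜ e0)) = leg12 gauge01 * e0 ⊗ₜ (e1 ⊗ₜ e0) := by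
  have hI := Complex.I_mul_I
  simp only [gauge01, Phi010, map_one, map_add, map_mul, map_sub, map_smul, legs_tmul,
    idComul_tmul, fermionicComul_E, fermionicComul_G, fermionicComul_ω]
  simp only [mul_assoc]
  simp only [expand_mul, expand_tmul, mul_rules, idempotent_rules]
  match_scalars <;> grind

theorem gauge_cocycle_001 :
    leg23 gauge01 * (idComul Δ₀ gauge01 * e0 ⊗ₜ (e0 ⊗ₜ e1)) =
      comulId Δ₀ gauge01 * e0 ⊗ₜ (e0 ⊗ₜ e1) := by
  have hI := Complex.I_mul_I
  simp only [gauge01, map_one, map_add, map_mul, map_sub, map_smul, legs_tmul,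
    idComul_tmul, comulId_tmul, fermionicComul_E, fermionicComul_G, fermionicComul_ω]
  simp only [mul_assoc]
  simp only [expand_mul, expand_tmul, mul_rules, idempotent_rules]
  match_scalars <;> grind

theorem Phi101_mul_gauge :
    Phi101 * (leg23 gauge01 * (leg12 gauge11 * e1 ⊗ₜ (e0 ⊗ₜ e1))) =
      comulId Δ₀ gauge11 * e1 ⊗ₜ (e0 ⊗ₜ e1) := by
  have hI := Complex.I_mul_I
  simp only [gauge01, gauge11, Phi101, map_one, map_add, map_mul, map_sub, map_smul, legs_tmul,
    comulId_tmul, fermionicComul_E, fermionicComul_G, fermionicComul_ω]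
  simp only [mul_assoc]
  simp only [expand_mul, expand_tmul, mul_rules, idempotent_rules]
  match_scalars <;> grind

theorem Phi111_mul_gauge :
    Phi111 β * (leg23 gauge11 * e1 ⊗ₜ (e1 ⊗ₜ e1)) =
      leg12 gauge11 * (comulId Δ₀ gauge01 * (κ β * e1) ⊗ₜ (e1 ⊗ₜ e1)) := by
  have hI := Complex.I_mul_I
  simp only [gauge01, gauge11, κ, Phi111, map_one, map_add, map_mul, map_sub, map_smul, legs_tmul,
    comulId_tmul, fermionicComul_E, fermionicComul_G]
  simp only [mul_assoc]
  simp only [expand_mul, expand_tmul, mul_rules, idempotent_rules]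
  match_scalars <;> grind

theorem gauge_cocycle_011 :
    leg23 gauge11 * e0 ⊗ₜ (e1 ⊗ₜ e1) =
      leg12 gauge01 * (comulId Δ₀ gauge11 * (κ β * e0) ⊗ₜ (e1 ⊗ₜ e1)) := by
  have hI := Complex.I_mul_I
  simp only [gauge01, gauge11, κ, map_one, map_add, map_mul, map_sub, map_smul, legs_tmul,
    comulId_tmul, fermionicComul_E, fermionicComul_G, fermionicComul_ω]
  simp only [mul_assoc]
  simp only [expand_mul, expand_tmul, mul_rules, idempotent_rules]
  match_scalars <;> grind

theorem idComul_gauge11 : idComul Δ₀ gauge11 = leg12 gauge11 := by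
  simp only [gauge11, legs_tmul, idComul_tmul, map_one, expand_tmul, mul_one,
    Algebra.TensorProduct.one_def]

theorem Phi_mul_gauge :
    Phi β * (leg23 gaugeElement * idComul Δ₀ gaugeElement) =
      leg12 gaugeElement * (comulId Δ₀ gaugeElement * parityCoassociator e1 (κ β)) := by
  apply tensor_ext₃ <;> simp only [mul_assoc] <;>
    simp only [Phi, gaugeElement, parityCoassociator, map_add, map_mul, legs_tmul, idComul_tmul,
      comulId_tmul, fermionicComul_e0, fermionicComul_e1, map_one, expand_mul, expand_tmul,
      idempotent_rules, commute_e0, commute_e1, Commute.one_left,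
      (commute_e0 (κ β)).left_comm, (commute_e1 (κ β)).left_comm,
      tmul_mul_left_comm _ _ _ (leg12 _), tmul_mul_left_comm _ _ _ (leg23 _),
      tmul_mul_left_comm _ _ _ (comulId Δ₀ _), tmul_mul_left_comm _ _ _ (idComul Δ₀ _),
      implies_true, Phi010_mul_gauge, gauge_cocycle_001, gauge_cocycle_011 (β := β),
      Phi101_mul_gauge, Phi111_mul_gauge, idComul_gauge11, add_sub_cancel]

end Comparison

end RestrictedSL2

end

theorem theorem2 (β : ℂ) (hβ : β ^ 4 = -1) :
    (∃ H : QuasiHopf.QuasiTriangularQuasiHopfAlgebra RestrictedSL2.Q,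
      H.comul = Bialgebra.comulAlgHom ℂ RestrictedSL2.Q ∧
      H.counit = Bialgebra.counitAlgHom ℂ RestrictedSL2.Q ∧
      H.antipode = HopfAlgebra.antipode ℂ ∧
      (H.coassociator : QuasiHopf.T3 RestrictedSL2.Q) = RestrictedSL2.Phi β ∧
      (H.rMatrix : RestrictedSL2.Q ⊗[ℂ] RestrictedSL2.Q) = RestrictedSL2.RMat β ∧
      H.evalElt = 1 ∧
      H.coevalElt = RestrictedSL2.e0 -
        (2 * Complex.I * β ^ 2) • (RestrictedSL2.Casimir * RestrictedSL2.e1)) ∧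
    RestrictedSL2.R00 = RestrictedSL2.RStandard ∧
    RestrictedSL2.RMat β * RestrictedSL2.e0 ⊗ₜ RestrictedSL2.e0 =
      RestrictedSL2.RStandard * RestrictedSL2.e0 ⊗ₜ RestrictedSL2.e0 :=
  ⟨⟨(RestrictedSL2.fermionicQuasiHopf hβ).twist RestrictedSL2.gauge_isCounital,
    QuasiHopf.twistComul_inv_twistComul RestrictedSL2.gauge, rfl, rfl,
    QuasiHopf.coe_twistCoassociator_eq_iff.2 RestrictedSL2.Phi_mul_gauge.symm,
    QuasiHopf.coe_twistRMatrix_eq_iff.2 RestrictedSL2.RMat_mul_gauge.symm,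
    RestrictedSL2.sandwich₂_gauge_inv_fermionicEval,
    RestrictedSL2.sandwich₂_gauge_fermionicCoeval⟩,
    RestrictedSL2.R00_eq_RStandard, RestrictedSL2.RMat_mul_e0 β⟩
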